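/- Work over $\mathbb C$, with homogeneous coordinates $x_0,\dots,x_7$ on $\mathbb P^7$, and consider the quadratic forms $$ \begin{aligned} Q_0={}&x_0(x_3+x_5+2x_6+3x_7)+x_1(-x_5+5x_6+2x_7)\\ &-x_2x_3-x_2x_4+x_2x_5+x_3^2-x_4x_6+x_5^2+x_6^2+x_7^2,\\ Q_1={}&x_0(-x_2+3x_5+7x_6+11x_7)+x_1(x_4+9x_5+4x_6+x_7)\\ &+x_2^2-x_2x_3+2x_3x_6+x_4^2+3x_4x_7+2x_5^2+3x_6^2+5x_7^2,\\ Q_2={}&x_0(11x_5+13x_6+8x_7)+x_1(-x_3+6x_5+7x_6+3x_7)\\ &+x_2^2+5x_2x_7-x_3x_4+9x_3x_5+13x_5^2+4x_6^2+11x_7^2. \end{aligned} $$ Let $X\subset\mathbb P^7$ be the closed subscheme $Q_0=Q_1=Q_2=0$. Then: 1. $X$ is smooth over $\mathbb C$, of dimension $4$. 2. $X$ is rational: a dense open subscheme of $X$ is isomorphic over $\mathbb C$ to a dense open subscheme of $\mathbb A^4$. 3. $X$ contains the line $\ell:\ x_2=\dots=x_7=0$. 4. Identify the space of $2$-planes $\Pi\subset\mathbb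 P^7$ containing $\ell$ with $\mathbb P^5$, a point $[y_0:\dots:y_5]$ corresponding to the plane spanned by $\ell$ and $[0:0:y_0:\dots:y_5]$, and let $$Q=\bigl\{([\lambda_0:\lambda_1:\lambda_2],\Pi)\ :\ \ell\subset\Pi\subset\{\lambda_0Q_0+\lambda_1Q_1+\lambda_2Q_2=0\}\bigr\}\subset\mathbb P^2\times\mathbb P^5 .$$ The first projection $Q\to\mathbb P^2$ is a quadric surface bundle: every fibre is a quadric surface in a linear subspace $\mathbb P^3\subset\mathbb P^5$, and the fibres over a nonempty Zariski open subset of $\mathbb P^2$ are smooth quadric surfaces. 5. The map $[\lambda_0:\lambda_1:\lambda_2]\mapsto[\lambda_0:\lambda_1:\lambda_2:0:0:0]\in\mathbb P^5$ is a rational section of $Q\to\mathbb P^2$; that is, the plane spanned by $\ell$ and $[0:0:\lambda_0:\lambda_1:\lambda_2:0:0:0]$ is contained in the quadric $\lambda_0Q_0+\lambda_1Q_1+\lambda_2Q_2=0$. -/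

import Mathlib

open AlgebraicGeometry CategoryTheory MvPolynomial
open scoped HomogeneousIdeal LinearAlgebra.Projectivization

noncomputable section

namespace ThreeQuadrics

attribute [local instance] MvPolynomial.gradedAlgebra

/-! ### Closed subschemes of projective space cut out by homogeneous ideals -/

section Proj

variable {σ : Type} (I : HomogeneousIdeal (homogeneousSubmodule σ ℂ))

/-- The grading on `ℂ[x_σ] / I` induced by the degree, for a homogeneous ideal `I`. -/
def quotGrading (n : ℕ) : Submodule ℂ (MvPolynomial σ ℂ ⧸ I.toIdeal) :=
  (homogeneousSubmodule σ ℂ n).map (Ideal.Quotient.mkₐ ℂ I.toIdeal).toLinearMap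

theorem mk_mem_quotGrading {n : ℕ} {p : MvPolynomial σ ℂ} (hp : p ∈ homogeneousSubmodule σ ℂ n) :
    Ideal.Quotient.mk I.toIdeal p ∈ quotGrading I n :=
  ⟨p, hp, rfl⟩

instance quotGrading_gradedMonoid : SetLike.GradedMonoid (quotGrading I) where
  one_mem := ⟨1, SetLike.GradedOne.one_mem, map_one (Ideal.Quotient.mk I.toIdeal)⟩
  mul_mem := by
    rintro i j _ _ ⟨p, hp, rfl⟩ ⟨q, hq, rfl⟩
    exact ⟨p * q, SetLike.GradedMul.mul_mem hp hq, map_mul (Ideal.Quotient.mk I.toIdeal) p q⟩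

/-- The degree `n` part of the residue class map. -/
def mkComponent (n : ℕ) : homogeneousSubmodule σ ℂ n →ₗ[ℂ] quotGrading I n :=
  (Ideal.Quotient.mkₐ ℂ I.toIdeal).toLinearMap.restrict fun _ hp => ⟨_, hp, rfl⟩

/-- The residue class map on direct sums, degree by degree. -/
def mkDirectSum :
    (DirectSum ℕ fun n => homogeneousSubmodule σ ℂ n) →ₐ[ℂ] DirectSum ℕ fun n => quotGrading I n :=
  DirectSum.toAlgebra ℂ (fun n => homogeneousSubmodule σ ℂ n)
    (fun n => (DirectSum.lof ℂ ℕ (fun n => quotGrading I n) n).comp (mkComponent I n))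
    (by
      change DirectSum.of (fun n => quotGrading I n) 0 _ = 1
      rw [DirectSum.one_def]; congr 1)
    (by
      intro i j a b
      change DirectSum.of (fun n => quotGrading I n) _ _
        = DirectSum.of (fun n => quotGrading I n) _ _ * DirectSum.of (fun n => quotGrading I n) _ _
      rw [DirectSum.of_mul_of]
      congr 1)

theorem mkDirectSum_of (n : ℕ) (p : homogeneousSubmodule σ ℂ n) :
    mkDirectSum I (DirectSum.of (fun n => homogeneousSubmodule σ ℂ n) n p)
      = DirectSum.of (fun n => quotGrading I n) n (mkComponent I n p) :=
  DirectSum.toAddMonoid_of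
    (fun n => ((DirectSum.lof ℂ ℕ (fun n => quotGrading I n) n).comp
      (mkComponent I n)).toAddMonoidHom) n p

/-- The homogeneous components of the residue class of a polynomial. -/
def preDecompose : MvPolynomial σ ℂ →ₐ[ℂ] DirectSum ℕ fun n => quotGrading I n :=
  (mkDirectSum I).comp (DirectSum.decomposeAlgEquiv (homogeneousSubmodule σ ℂ)).toAlgHom

theorem preDecompose_of_mem {n : ℕ} {p : MvPolynomial σ ℂ} (hp : p ∈ homogeneousSubmodule σ ℂ n) :
    preDecompose I p
      = DirectSum.of (fun n => quotGrading I n) n ⟨_, mk_mem_quotGrading I hp⟩ := by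
  have h : DirectSum.decompose (homogeneousSubmodule σ ℂ) p
      = DirectSum.of (fun n => homogeneousSubmodule σ ℂ n) n ⟨p, hp⟩ :=
    DirectSum.decompose_of_mem _ hp
  change mkDirectSum I (DirectSum.decompose (homogeneousSubmodule σ ℂ) p) = _
  rw [h, mkDirectSum_of]
  rfl

theorem preDecompose_eq_zero {p : MvPolynomial σ ℂ} (hp : p ∈ I.toIdeal) :
    preDecompose I p = 0 := by
  classical
  rw [← DirectSum.sum_support_decompose (homogeneousSubmodule σ ℂ) p, map_sum]
  refine Finset.sum_eq_zero fun n _ => ?_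
  rw [preDecompose_of_mem I (SetLike.coe_mem _)]
  have h : (DirectSum.decompose (homogeneousSubmodule σ ℂ) p n : MvPolynomial σ ℂ) ∈ I.toIdeal :=
    I.isHomogeneous n hp
  have h0 : (⟨_, mk_mem_quotGrading I
      (SetLike.coe_mem (DirectSum.decompose (homogeneousSubmodule σ ℂ) p n))⟩ :
      quotGrading I n) = 0 := Subtype.ext (Ideal.Quotient.eq_zero_iff_mem.mpr h)
  rw [h0, map_zero]

instance quotGrading_gradedAlgebra : GradedAlgebra (quotGrading I) :=
  GradedAlgebra.ofAlgHom _
    (Ideal.Quotient.liftₐ I.toIdeal (preDecompose I) fun _ hp => preDecompose_eq_zero I hp)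
    (by
      classical
      apply AlgHom.ext
      intro x
      obtain ⟨p, rfl⟩ := Ideal.Quotient.mk_surjective x
      change DirectSum.coeAlgHom _ (preDecompose I p) = Ideal.Quotient.mk _ p
      conv_lhs => rw [← DirectSum.sum_support_decompose (homogeneousSubmodule σ ℂ) p]
      conv_rhs => rw [← DirectSum.sum_support_decompose (homogeneousSubmodule σ ℂ) p]
      rw [map_sum, map_sum, map_sum]
      refine Finset.sum_congr rfl fun n _ => ?_
      rw [preDecompose_of_mem I (SetLike.coe_mem _)]
      exact DirectSum.coeAlgHom_of _ _ _)
    (by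
      rintro n ⟨_, p, hp, rfl⟩
      exact preDecompose_of_mem I hp)

/-- The closed subscheme of projective space defined by the homogeneous ideal `I`,
i.e. `Proj (ℂ[x_σ] / I)`. -/
def projScheme : Scheme.{0} := Proj (quotGrading I)

/-- The structure morphism to `Spec ℂ`. -/
def projStr : projScheme I ⟶ Spec (CommRingCat.of ℂ) :=
  Proj.toSpecZero (quotGrading I) ≫
    Spec.map (CommRingCat.ofHom (algebraMap ℂ (quotGrading I 0)))

/-- The residue class map as a map of graded rings. -/
def mkGraded : homogeneousSubmodule σ ℂ →+*ᵍ quotGrading I where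
  toRingHom := Ideal.Quotient.mk I.toIdeal
  map_mem := mk_mem_quotGrading I

theorem irrelevant_le_map_mkGraded :
    HomogeneousIdeal.irrelevant (quotGrading I)
      ≤ (HomogeneousIdeal.irrelevant (homogeneousSubmodule σ ℂ)).map (mkGraded I) := by
  rw [HomogeneousIdeal.irrelevant_le]
  rintro n hn _ ⟨p, hp, rfl⟩
  exact Ideal.mem_map_of_mem (mkGraded I)
    (HomogeneousIdeal.mem_irrelevant_of_mem (homogeneousSubmodule σ ℂ) hn hp)

/-- The embedding into projective space `Proj ℂ[x_σ]`. -/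
def projEmb : projScheme I ⟶ Proj (homogeneousSubmodule σ ℂ) :=
  Proj.map (mkGraded I) (irrelevant_le_map_mkGraded I)

/-- The homogeneous ideal generated by a family of homogeneous polynomials. -/
def idealOf {ι : Type} (f : ι → MvPolynomial σ ℂ) (d : ι → ℕ)
    (hf : ∀ i, (f i).IsHomogeneous (d i)) : HomogeneousIdeal (homogeneousSubmodule σ ℂ) where
  toSubmodule := Ideal.span (Set.range f)
  is_homogeneous' := Ideal.homogeneous_span _ _ (by
    rintro _ ⟨i, rfl⟩
    exact ⟨d i, hf i⟩)

end Proj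

/-! ### The three quadrics, the fourfold and the line -/

/-- The quadratic form `Q_0`. -/
def quadric₀ : MvPolynomial (Fin 8) ℂ :=
  X 0 * (X 3 + X 5 + C 2 * X 6 + C 3 * X 7) + X 1 * (-X 5 + C 5 * X 6 + C 2 * X 7)
    - X 2 * X 3 - X 2 * X 4 + X 2 * X 5 + X 3 ^ 2 - X 4 * X 6 + X 5 ^ 2 + X 6 ^ 2 + X 7 ^ 2

/-- The quadratic form `Q_1`. -/
def quadric₁ : MvPolynomial (Fin 8) ℂ :=
  X 0 * (-X 2 + C 3 * X 5 + C 7 * X 6 + C 11 * X 7)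
    + X 1 * (X 4 + C 9 * X 5 + C 4 * X 6 + X 7)
    + X 2 ^ 2 - X 2 * X 3 + C 2 * (X 3 * X 6) + X 4 ^ 2 + C 3 * (X 4 * X 7)
    + C 2 * X 5 ^ 2 + C 3 * X 6 ^ 2 + C 5 * X 7 ^ 2

/-- The quadratic form `Q_2`. -/
def quadric₂ : MvPolynomial (Fin 8) ℂ :=
  X 0 * (C 11 * X 5 + C 13 * X 6 + C 8 * X 7)
    + X 1 * (-X 3 + C 6 * X 5 + C 7 * X 6 + C 3 * X 7)
    + X 2 ^ 2 + C 5 * (X 2 * X 7) - X 3 * X 4 + C 9 * (X 3 * X 5)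
    + C 13 * X 5 ^ 2 + C 4 * X 6 ^ 2 + C 11 * X 7 ^ 2

/-- The three quadratic forms. -/
def quadric : Fin 3 → MvPolynomial (Fin 8) ℂ := ![quadric₀, quadric₁, quadric₂]

theorem isHomogeneous_quadric (i : Fin 3) : (quadric i).IsHomogeneous 2 := by
  have h1 : ∀ j : Fin 8, (X j : MvPolynomial (Fin 8) ℂ).IsHomogeneous 1 := fun j =>
    isHomogeneous_X ℂ j
  have hC : ∀ (c : ℂ) {n : ℕ} {p : MvPolynomial (Fin 8) ℂ}, p.IsHomogeneous n →
      (C c * p).IsHomogeneous n := fun c n p hp => by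
    simpa using (isHomogeneous_C (Fin 8) c).mul hp
  have hm : ∀ {p q : MvPolynomial (Fin 8) ℂ}, p.IsHomogeneous 1 → q.IsHomogeneous 1 →
      (p * q).IsHomogeneous 2 := fun hp hq => hp.mul hq
  have hs : ∀ j : Fin 8, (X j ^ 2 : MvPolynomial (Fin 8) ℂ).IsHomogeneous 2 := fun j => by
    simpa using (h1 j).pow 2
  have ha : ∀ {n : ℕ} {p q : MvPolynomial (Fin 8) ℂ}, p.IsHomogeneous n → q.IsHomogeneous n →
      (p + q).IsHomogeneous n := fun hp hq => hp.add hq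
  have hb : ∀ {n : ℕ} {p q : MvPolynomial (Fin 8) ℂ}, p.IsHomogeneous n → q.IsHomogeneous n →
      (p - q).IsHomogeneous n := fun hp hq => hp.sub hq
  have hn : ∀ {n : ℕ} {p : MvPolynomial (Fin 8) ℂ}, p.IsHomogeneous n →
      (-p).IsHomogeneous n := fun hp => hp.neg
  have h₀ : quadric₀.IsHomogeneous 2 := by
    unfold quadric₀
    with_reducible
      repeat' first | apply h1 | apply hs | apply ha | apply hb | apply hn | apply hC | apply hm
  have h₁ : quadric₁.IsHomogeneous 2 := by
    unfold quadric₁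
    with_reducible
      repeat' first | apply h1 | apply hs | apply ha | apply hb | apply hn | apply hC | apply hm
  have h₂ : quadric₂.IsHomogeneous 2 := by
    unfold quadric₂
    with_reducible
      repeat' first | apply h1 | apply hs | apply ha | apply hb | apply hn | apply hC | apply hm
  match i with
  | 0 => exact h₀
  | 1 => exact h₁
  | 2 => exact h₂

/-- The homogeneous ideal `(Q_0, Q_1, Q_2)`. -/
def idealX : HomogeneousIdeal (homogeneousSubmodule (Fin 8) ℂ) :=
  idealOf quadric (fun _ => 2) isHomogeneous_quadric

/-- The intersection `X = {Q_0 = Q_1 = Q_2 = 0}` in `ℙ⁷`. -/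
def fourfold : Scheme.{0} := projScheme idealX

/-- The structure morphism `X ⟶ Spec ℂ`. -/
def fourfoldStr : fourfold ⟶ Spec (CommRingCat.of ℂ) := projStr idealX

/-- The homogeneous ideal `(x_2, …, x_7)`. -/
def idealLine : HomogeneousIdeal (homogeneousSubmodule (Fin 8) ℂ) :=
  idealOf (fun j : Fin 6 => X (Fin.natAdd 2 j)) (fun _ => 1) fun _ => isHomogeneous_X ℂ _

/-! ### The quadric surface bundle associated with the line -/

/-- The two-dimensional subspace of `ℂ⁸` whose projectivization is the line
`x_2 = … = x_7 = 0`. -/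
def lineSpace : Submodule ℂ (Fin 8 → ℂ) where
  carrier := {v | ∀ j : Fin 6, v (Fin.natAdd 2 j) = 0}
  zero_mem' := fun _ => rfl
  add_mem' := fun {v w} hv hw j => by simp [hv j, hw j]
  smul_mem' := fun c v hv j => by simp [hv j]

/-- The projective plane spanned by the line and the point `[0 : 0 : y_0 : … : y_5]`
(for `y ≠ 0`), as a linear subspace of `ℂ⁸`. -/
def planeThrough (y : Fin 6 → ℂ) : Submodule ℂ (Fin 8 → ℂ) :=
  lineSpace ⊔ Submodule.span ℂ {![0, 0, y 0, y 1, y 2, y 3, y 4, y 5]}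

/-- The set of pairs `([λ_0 : λ_1 : λ_2], Π)`, where `Π` is a plane in `ℙ⁷` that contains the
line and is contained in the quadric `λ_0 Q_0 + λ_1 Q_1 + λ_2 Q_2 = 0`. -/
def quadricBundle : Set (ℙ ℂ (Fin 3 → ℂ) × Submodule ℂ (Fin 8 → ℂ)) :=
  {p | Module.finrank ℂ p.2 = 3 ∧ lineSpace ≤ p.2 ∧
    ∀ v ∈ p.2, ∑ i, p.1.rep i * eval v (quadric i) = 0}

/-- The fibre of the first projection over `l`, inside the space `ℙ⁵` of planes containing the
line. -/
def bundleFiber (l : ℙ ℂ (Fin 3 → ℂ)) : Set (ℙ ℂ (Fin 6 → ℂ)) :=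
  {y | (l, planeThrough y.rep) ∈ quadricBundle}

/-- `S` is the zero locus of the quadratic form `q` on the projective 3-space `ℙ(W)`. -/
def IsQuadricIn (S : Set (ℙ ℂ (Fin 6 → ℂ))) (W : Submodule ℂ (Fin 6 → ℂ))
    (q : QuadraticForm ℂ W) : Prop :=
  Module.finrank ℂ W = 4 ∧ ∀ y : ℙ ℂ (Fin 6 → ℂ), y ∈ S ↔ ∃ h : y.rep ∈ W, q ⟨y.rep, h⟩ = 0

/-- `S` is a quadric surface in a three-dimensional linear subspace of `ℙ⁵`. -/
def IsQuadricSurface (S : Set (ℙ ℂ (Fin 6 → ℂ))) : Prop :=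
  ∃ (W : Submodule ℂ (Fin 6 → ℂ)) (q : QuadraticForm ℂ W), q ≠ 0 ∧ IsQuadricIn S W q

/-- `S` is a smooth quadric surface in a three-dimensional linear subspace of `ℙ⁵`. -/
def IsSmoothQuadricSurface (S : Set (ℙ ℂ (Fin 6 → ℂ))) : Prop :=
  ∃ (W : Submodule ℂ (Fin 6 → ℂ)) (q : QuadraticForm ℂ W),
    (QuadraticMap.polarBilin q).Nondegenerate ∧ IsQuadricIn S W q

/-- The rational map `ℙ² ⇢ ℙ⁵` given by the forms `s_0, …, s_5` of equal degree, not all zero,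
is a rational section of the bundle: wherever the `s_j` do not all vanish, the plane through the
line and the point `[0 : 0 : s_0(λ) : … : s_5(λ)]` lies in the fibre over `λ`. -/
def IsRationalSection (s : Fin 6 → MvPolynomial (Fin 3) ℂ) : Prop :=
  (∃ d, ∀ j, (s j).IsHomogeneous d) ∧ s ≠ 0 ∧
    ∀ l : ℙ ℂ (Fin 3 → ℂ), (fun j => eval l.rep (s j)) ≠ 0 →
      (l, planeThrough fun j => eval l.rep (s j)) ∈ quadricBundle

end ThreeQuadrics

end

open AlgebraicGeometry CategoryTheory MvPolynomial
open scoped HomogeneousIdeal LinearAlgebra.Projectivization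

noncomputable section

namespace ThreeQuadrics

attribute [local instance] MvPolynomial.gradedAlgebra

/-! ### Reduction of integral equations to positive characteristic -/

section Reduction

/-! The argument studies the net of quadrics λ_0Q_0 + λ_1Q_1 + λ_2Q_2. Since ℓ lies in every Q_i,
each Q_i has degree at most one in (x_0, x_1).

Smoothness. By the Jacobian criterion it suffices that no point of X is a singular point of a member
of the net (`point_eq_zero`). A counterexample over ℂ can be scaled to primitive vectors over a
valuation ring of residue characteristic 7 and reduced. There a vertex of the member λ gives a
kernel vector w of a symmetric 4 × 4 Gram matrix. Its adjugate is a multiple of w wᵀ, so the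
derivatives of the determinant in λ are multiples of values of the Q_i at the vertex, hence zero
(`detDeriv_eq_zero`). So λ would be a singular point of the discriminant curve, which explicit
Bézout identities modulo 7 exclude (`net_certificate`, `pencil_certificate`).

Bundle. A plane through ℓ lies in the member λ iff its direction y ∈ ℂ⁶ satisfies two linear
equations (tangency along ℓ) and one quadratic equation. The linear equations are independent
because X is nonsingular along ℓ. The quadratic form is nondegenerate where the 8 × 8 discriminant
is nonzero, by the usual passage from a space to L^⊥/L for an isotropic L.

Rationality. Through a general x ∈ X the plane ⟨ℓ, x⟩ lies in exactly one member, with λ the cross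
product of the coefficient vectors of x_0 and x_1; conversely, a general plane in the bundle
contains one point of X off ℓ. So X is birational to the bundle, and projecting its fibres from the
rational section parametrizes them linearly. Written out, this is an isomorphism between
localizations of coordinate rings (`nonempty_openRing_algEquiv`).

Density. The chart so obtained is the locus `openForm` ≠ 0 in X. Components of the cone over X have
dimension at least five, while the part of the cone where `openForm` vanishes is finite over ℂ⁴ by
four linear forms: they have no common nonzero zero there, as a reduction modulo 5 shows. Hence no
component lies in the complement (`mem_radical_of_mul_openForm_mem`). -/

theorem exists_valuationSubring_residueField_natCast_eq_zero (K : Type*) [Field K] [CharZero K]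
    (p : ℕ) (hp : p.Prime) :
    ∃ V : ValuationSubring K, (p : IsLocalRing.ResidueField V) = 0 := by
  let A : Subring K := (Int.castRingHom K).range
  let a : A := ⟨(p : K), ⟨p, by simp⟩⟩
  have hA : Ideal.span {a} ≠ ⊤ := by
    rw [Ne, Ideal.span_singleton_eq_top]
    intro h
    obtain ⟨⟨b, n, rfl⟩, hb⟩ := isUnit_iff_exists_inv.mp h
    have hb' : (p : K) * (n : K) = 1 := congrArg Subtype.val hb
    have : (p : ℤ) * n = 1 := by exact_mod_cast hb'
    have := Int.isUnit_iff.mp (IsUnit.of_mul_eq_one _ this)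
    have := hp.two_le
    omega
  -- The ideal (p) of the image of ℤ is proper, so some valuation ring of K contains that image and
  -- has p among its nonunits.
  obtain ⟨V, -, hV⟩ := Ideal.image_subset_nonunits_valuationSubring _ hA
  refine ⟨V, ?_⟩
  have h1 : (p : K) ∈ V.nonunits := hV ⟨a, Ideal.subset_span rfl, rfl⟩
  obtain ⟨x, hx, hx'⟩ := V.image_maximalIdeal.symm.subset h1
  have hxp : x = (p : V) := Subtype.ext (by simpa using hx')
  rw [← map_natCast (IsLocalRing.residue V), ← hxp]
  exact Ideal.Quotient.eq_zero_iff_mem.mpr hx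

/-- Dividing by an entry of largest valuation makes all entries integral and one of them 1, so the
vector stays nonzero in the residue field. -/
theorem exists_smul_mem_valuationSubring {K ι : Type*} [Field K] [Finite ι]
    (V : ValuationSubring K) {v : ι → K} (hv : v ≠ 0) :
    ∃ (c : K) (w : ι → V), (∀ i, (w i : K) = c * v i) ∧ ∃ i, w i = 1 := by
  obtain ⟨i₀, hi₀⟩ := Function.ne_iff.mp hv
  have : Nonempty ι := ⟨i₀⟩
  obtain ⟨i, hi⟩ := Finite.exists_max fun i => V.valuation (v i)
  have hvi : v i ≠ 0 := fun h => hi₀ (by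
    have := hi i₀
    rw [h, map_zero, le_zero_iff, map_eq_zero] at this
    exact this)
  refine ⟨(v i)⁻¹, fun j => ⟨(v i)⁻¹ * v j, ?_⟩, fun j => rfl, i, ?_⟩
  · rw [← V.valuation_le_one_iff, map_mul, map_inv₀]
    have h0 : V.valuation (v i) ≠ 0 := by simpa using hvi
    calc _ ≤ (V.valuation (v i))⁻¹ * V.valuation (v i) := by gcongr; exact hi j
      _ = 1 := inv_mul_cancel₀ h0
  · exact Subtype.ext (inv_mul_cancel₀ hvi)

end Reduction

/-! ### The quadratic forms over an arbitrary ring -/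

section Forms

variable {R S : Type*} [CommRing R] [CommRing S]

/-- The values of the three quadratic forms at a vector. -/
def quadVal (x : Fin 8 → R) : Fin 3 → R :=
  ![x 0 * (x 3 + x 5 + 2 * x 6 + 3 * x 7) + x 1 * (-x 5 + 5 * x 6 + 2 * x 7)
      - x 2 * x 3 - x 2 * x 4 + x 2 * x 5 + x 3 ^ 2 - x 4 * x 6 + x 5 ^ 2 + x 6 ^ 2 + x 7 ^ 2,
    x 0 * (-x 2 + 3 * x 5 + 7 * x 6 + 11 * x 7) + x 1 * (x 4 + 9 * x 5 + 4 * x 6 + x 7)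
      + x 2 ^ 2 - x 2 * x 3 + 2 * (x 3 * x 6) + x 4 ^ 2 + 3 * (x 4 * x 7)
      + 2 * x 5 ^ 2 + 3 * x 6 ^ 2 + 5 * x 7 ^ 2,
    x 0 * (11 * x 5 + 13 * x 6 + 8 * x 7) + x 1 * (-x 3 + 6 * x 5 + 7 * x 6 + 3 * x 7)
      + x 2 ^ 2 + 5 * (x 2 * x 7) - x 3 * x 4 + 9 * (x 3 * x 5)
      + 13 * x 5 ^ 2 + 4 * x 6 ^ 2 + 11 * x 7 ^ 2]

/-- The gradients of the three quadratic forms at a vector. -/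
def quadGrad (x : Fin 8 → R) : Fin 3 → Fin 8 → R :=
  ![![x 3 + x 5 + 2 * x 6 + 3 * x 7,
      -x 5 + 5 * x 6 + 2 * x 7,
      -x 3 - x 4 + x 5,
      x 0 - x 2 + 2 * x 3,
      -x 2 - x 6,
      x 0 - x 1 + x 2 + 2 * x 5,
      2 * x 0 + 5 * x 1 - x 4 + 2 * x 6,
      3 * x 0 + 2 * x 1 + 2 * x 7],
    ![-x 2 + 3 * x 5 + 7 * x 6 + 11 * x 7,
      x 4 + 9 * x 5 + 4 * x 6 + x 7,
      -x 0 + 2 * x 2 - x 3,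
      -x 2 + 2 * x 6,
      x 1 + 2 * x 4 + 3 * x 7,
      3 * x 0 + 9 * x 1 + 4 * x 5,
      7 * x 0 + 4 * x 1 + 2 * x 3 + 6 * x 6,
      11 * x 0 + x 1 + 3 * x 4 + 10 * x 7],
    ![11 * x 5 + 13 * x 6 + 8 * x 7,
      -x 3 + 6 * x 5 + 7 * x 6 + 3 * x 7,
      2 * x 2 + 5 * x 7,
      -x 1 - x 4 + 9 * x 5,
      -x 3,
      11 * x 0 + 6 * x 1 + 9 * x 3 + 26 * x 5,
      13 * x 0 + 7 * x 1 + 8 * x 6,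
      8 * x 0 + 3 * x 1 + 5 * x 2 + 22 * x 7]]

theorem map_quadVal (f : R →+* S) (x : Fin 8 → R) (i : Fin 3) :
    f (quadVal x i) = quadVal (fun j => f (x j)) i := by
  fin_cases i <;> simp [quadVal, map_ofNat]

theorem map_quadGrad (f : R →+* S) (x : Fin 8 → R) (i : Fin 3) (j : Fin 8) :
    f (quadGrad x i j) = quadGrad (fun j => f (x j)) i j := by
  fin_cases i <;> fin_cases j <;> simp [quadGrad, map_ofNat]

theorem quadVal_smul (c : R) (x : Fin 8 → R) (i : Fin 3) :
    quadVal (fun j => c * x j) i = c ^ 2 * quadVal x i := by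
  fin_cases i <;> simp [quadVal] <;> ring

theorem quadGrad_smul (c : R) (x : Fin 8 → R) (i : Fin 3) (j : Fin 8) :
    quadGrad (fun j => c * x j) i j = c * quadGrad x i j := by
  fin_cases i <;> fin_cases j <;> simp [quadGrad] <;> ring

/-- Euler's relation in degree two. -/
theorem sum_quadGrad_mul (x : Fin 8 → R) (i : Fin 3) :
    ∑ j, quadGrad x i j * x j = 2 * quadVal x i := by
  fin_cases i <;> simp [quadGrad, quadVal, Fin.sum_univ_eight] <;> ring

theorem aeval_quadric [Algebra ℂ R] (x : Fin 8 → R) (i : Fin 3) :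
    aeval x (quadric i) = quadVal x i := by
  fin_cases i <;> simp [quadric, quadVal, quadric₀, quadric₁, quadric₂, map_ofNat]

theorem eval_quadric (x : Fin 8 → ℂ) (i : Fin 3) : eval x (quadric i) = quadVal x i := by
  rw [← aeval_quadric, MvPolynomial.aeval_eq_eval]

theorem pderiv_X_eq_ite {σ : Type*} [DecidableEq σ] (a j : σ) :
    pderiv j (X a : MvPolynomial σ ℂ) = if a = j then 1 else 0 := by
  rw [pderiv_X, Pi.single_apply]

theorem pderiv_quadric₀ (j : Fin 8) :
    pderiv j quadric₀ = quadGrad (fun j => (X j : MvPolynomial (Fin 8) ℂ)) 0 j := by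
  simp only [quadric₀, map_add, map_sub, map_neg, pderiv_C, pow_two,
    pderiv_X_eq_ite, Derivation.leibniz, smul_eq_mul]
  fin_cases j <;> simp [quadGrad, map_ofNat] <;> ring

theorem pderiv_quadric₁ (j : Fin 8) :
    pderiv j quadric₁ = quadGrad (fun j => (X j : MvPolynomial (Fin 8) ℂ)) 1 j := by
  simp only [quadric₁, map_add, map_sub, map_neg, pderiv_C, pow_two,
    pderiv_X_eq_ite, Derivation.leibniz, smul_eq_mul]
  fin_cases j <;> simp [quadGrad, map_ofNat] <;> ring

theorem pderiv_quadric₂ (j : Fin 8) :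
    pderiv j quadric₂ = quadGrad (fun j => (X j : MvPolynomial (Fin 8) ℂ)) 2 j := by
  simp only [quadric₂, map_add, map_sub, map_neg, pderiv_C, pow_two,
    pderiv_X_eq_ite, Derivation.leibniz, smul_eq_mul]
  fin_cases j <;> simp [quadGrad, map_ofNat] <;> ring

theorem pderiv_quadric (i : Fin 3) (j : Fin 8) :
    pderiv j (quadric i) = quadGrad (fun j => (X j : MvPolynomial (Fin 8) ℂ)) i j :=
  match i with
  | 0 => pderiv_quadric₀ j
  | 1 => pderiv_quadric₁ j
  | 2 => pderiv_quadric₂ j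

end Forms

/-! ### Computing with coefficient lists -/

/-- Polynomials in one variable, given by their lists of coefficients. -/
def LPoly (α : Type*) := List α

namespace LPoly

variable {α : Type*}

/-- Addition of coefficient lists. -/
def add [Add α] : List α → List α → List α
  | [], q => q
  | a :: p, [] => a :: p
  | a :: p, b :: q => (a + b) :: add p q

/-- Multiplication of coefficient lists. -/
def mul [Add α] [Mul α] [Zero α] : List α → List α → List α
  | [], _ => []
  | a :: p, q => add (q.map (a * ·)) (0 :: mul p q)

instance [Add α] : Add (LPoly α) := ⟨add⟩
instance [Add α] [Mul α] [Zero α] : Mul (LPoly α) := ⟨mul⟩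
instance [Neg α] : Neg (LPoly α) := ⟨List.map Neg.neg⟩
instance : Zero (LPoly α) := ⟨[]⟩

/-- A constant polynomial. -/
def const (a : α) : LPoly α := [a]

/-- The value of a coefficient list, where the coefficients are read through `φ`. -/
def eval {k : Type*} [CommRing k] (φ : α → k) (x : k) : List α → k
  | [] => 0
  | a :: p => φ a + x * eval φ x p

end LPoly

/-- Maps from a type with operations to a ring that respect the operations. -/
structure IsOpHom {β k : Type*} [Add β] [Mul β] [Neg β] [Zero β] [CommRing k] (φ : β → k) :
    Prop where
  add : ∀ a b, φ (a + b) = φ a + φ b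
  mul : ∀ a b, φ (a * b) = φ a * φ b
  neg : ∀ a, φ (-a) = -φ a
  zero : φ 0 = 0

theorem IsOpHom.intCast (k : Type*) [CommRing k] : IsOpHom (Int.cast : ℤ → k) :=
  ⟨Int.cast_add, Int.cast_mul, Int.cast_neg, Int.cast_zero⟩

/-- Coefficient lists may end in zeros and so do not form a ring; compatibility with the operations
is all that is needed to carry a kernel computation over to a field. Iterating it handles two
variables. -/
theorem IsOpHom.eval {β k : Type*} [Add β] [Mul β] [Neg β] [Zero β] [CommRing k] {φ : β → k}
    (h : IsOpHom φ) (x : k) : IsOpHom (β := LPoly β) (LPoly.eval φ x) := by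
  have hadd : ∀ p q : List β,
      LPoly.eval φ x (LPoly.add p q) = LPoly.eval φ x p + LPoly.eval φ x q := by
    intro p
    induction p with
    | nil => intro q; simp [LPoly.add, LPoly.eval]
    | cons a p ih =>
      intro q
      cases q with
      | nil => simp [LPoly.add, LPoly.eval]
      | cons b q => simp only [LPoly.add, LPoly.eval, ih, h.add]; ring
  have hsmul : ∀ (a : β) (q : List β),
      LPoly.eval φ x (q.map (a * ·)) = φ a * LPoly.eval φ x q := by
    intro a q
    induction q with
    | nil => simp [LPoly.eval]
    | cons b q ih => simp only [List.map_cons, LPoly.eval, ih, h.mul]; ring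
  have hmul : ∀ p q : List β,
      LPoly.eval φ x (LPoly.mul p q) = LPoly.eval φ x p * LPoly.eval φ x q := by
    intro p q
    induction p with
    | nil => simp [LPoly.mul, LPoly.eval]
    | cons a p ih => simp only [LPoly.mul, hadd, hsmul, LPoly.eval, ih, h.zero]; ring
  have hneg : ∀ p : List β, LPoly.eval φ x (p.map Neg.neg) = -LPoly.eval φ x p := by
    intro p
    induction p with
    | nil => simp [LPoly.eval]
    | cons a p ih => simp only [List.map_cons, LPoly.eval, ih, h.neg]; ring
  exact ⟨hadd, hmul, hneg, rfl⟩

theorem LPoly.eval_eq_zero_of_all {β k : Type*} [CommRing k] {φ : β → k} {P : β → Bool}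
    (hP : ∀ b, P b = true → φ b = 0) (x : k) (p : List β) (hp : p.all P = true) :
    LPoly.eval φ x p = 0 := by
  induction p with
  | nil => rfl
  | cons a p ih =>
    rw [List.all_cons, Bool.and_eq_true] at hp
    simp [LPoly.eval, hP a hp.1, ih hp.2]

/-! ### Singular symmetric matrices of size four -/

section Det

variable {β : Type*} [Add β] [Mul β] [Neg β]

/-- The sum of four elements. -/
def sumFour (f : Fin 4 → β) : β := f 0 + f 1 + f 2 + f 3

/-- The determinant of a `3 × 3` matrix. -/
def detThree (g : Fin 3 → Fin 3 → β) : β :=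
  g 0 0 * (g 1 1 * g 2 2 + -(g 1 2 * g 2 1)) + -(g 0 1 * (g 1 0 * g 2 2 + -(g 1 2 * g 2 0)))
    + g 0 2 * (g 1 0 * g 2 1 + -(g 1 1 * g 2 0))

/-- The cofactors of a `4 × 4` matrix. -/
def cofactor (g : Fin 4 → Fin 4 → β) (i j : Fin 4) : β :=
  if (i.val + j.val) % 2 = 0 then detThree fun a b => g (i.succAbove a) (j.succAbove b)
  else -detThree fun a b => g (i.succAbove a) (j.succAbove b)

/-- The pairing of the cofactor matrix of `g` with `h`, that is, the derivative of the
determinant at `g` in the direction `h`. -/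
def detDeriv (g h : Fin 4 → Fin 4 → β) : β :=
  sumFour fun i => sumFour fun j => cofactor g i j * h i j

/-- The determinant of a `4 × 4` matrix. -/
def detFour (g : Fin 4 → Fin 4 → β) : β := sumFour fun j => cofactor g 0 j * g 0 j

variable [Zero β] {k : Type*} [CommRing k] {φ : β → k}

theorem IsOpHom.cofactor (hφ : IsOpHom φ) (g : Fin 4 → Fin 4 → β) (i j : Fin 4) :
    φ (cofactor g i j) = ThreeQuadrics.cofactor (fun i j => φ (g i j)) i j := by
  unfold ThreeQuadrics.cofactor
  split_ifs <;> simp only [detThree, hφ.add, hφ.mul, hφ.neg]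

theorem IsOpHom.detDeriv (hφ : IsOpHom φ) (g h : Fin 4 → Fin 4 → β) :
    φ (detDeriv g h)
      = ThreeQuadrics.detDeriv (fun i j => φ (g i j)) fun i j => φ (h i j) := by
  simp only [ThreeQuadrics.detDeriv, sumFour, hφ.add, hφ.mul, hφ.cofactor]

theorem IsOpHom.detFour (hφ : IsOpHom φ) (g : Fin 4 → Fin 4 → β) :
    φ (detFour g) = ThreeQuadrics.detFour fun i j => φ (g i j) := by
  simp only [ThreeQuadrics.detFour, sumFour, hφ.add, hφ.mul, hφ.cofactor]

/-- Links the formula evaluated by the kernel with the adjugate, for which the linear algebra is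
proved. -/
theorem cofactor_eq_adjugate (g : Matrix (Fin 4) (Fin 4) k) (i j : Fin 4) :
    cofactor g i j = g.adjugate j i := by
  rw [Matrix.adjugate_fin_succ_eq_det_submatrix, Matrix.det_fin_three]
  simp only [Matrix.submatrix_apply]
  unfold cofactor detThree
  split_ifs with h
  · rw [Even.neg_one_pow (Nat.even_iff.mpr h)]; ring
  · rw [Odd.neg_one_pow (Nat.odd_iff.mpr (by omega))]; ring

end Det

section Adjugate

variable {n k : Type*} [Fintype n] [DecidableEq n]

/-- If `w` is in the kernel of `g`, every column of the adjugate is proportional to `w`. -/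
theorem adjugate_mul_apply_comm [CommRing k] {g : Matrix n n k} {w : n → k}
    (hw : g.mulVec w = 0) (a b c : n) : g.adjugate a b * w c = g.adjugate c b * w a := by
  -- Cramer's rule for g with row b replaced by the c-th unit vector: this matrix sends w to w_c
  -- times the b-th unit vector, has determinant adj(g)_{cb}, and its adjugate has the same column b
  -- as that of g.
  have h1 : (g.updateRow b (Pi.single c 1)).mulVec w = Pi.single b (w c) := by
    ext i
    by_cases hi : i = b
    · subst hi; simp [Matrix.mulVec]
    · have := congrFun hw i
      simp only [Matrix.mulVec, Matrix.updateRow_ne hi] at this ⊢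
      rw [this, Pi.single_eq_of_ne hi]; rfl
  have h2 := congrArg (fun v => ((g.updateRow b (Pi.single c 1)).adjugate.mulVec v) a) h1
  simp only [Matrix.mulVec_mulVec, Matrix.adjugate_mul, Matrix.smul_mulVec, Matrix.one_mulVec,
    Pi.smul_apply, smul_eq_mul, Matrix.mulVec_single] at h2
  have h3 : (g.updateRow b (Pi.single c 1)).adjugate a b = g.adjugate a b := by
    rw [Matrix.adjugate_apply, Matrix.adjugate_apply, Matrix.updateRow_idem]
  rw [← Matrix.adjugate_apply] at h2
  simp [h3] at h2
  linear_combination -h2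

/-- The derivative of the determinant at a singular symmetric matrix. -/
theorem sum_adjugate_mul_eq_zero [Field k] {g h : Matrix n n k} {w : n → k}
    (hg : g.IsSymm) (hw : g.mulVec w = 0) (hw0 : w ≠ 0)
    (hh : ∑ i, ∑ j, w i * w j * h i j = 0) : ∑ i, ∑ j, g.adjugate j i * h i j = 0 := by
  obtain ⟨c, hc⟩ := Function.ne_iff.mp hw0
  have hc : w c ≠ 0 := hc
  have hs : ∀ a b, g.adjugate a b = g.adjugate b a := fun a b =>
    congrFun (congrFun ((Matrix.adjugate_transpose g).trans (congrArg _ hg.eq)) b) a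
  -- Symmetry of the adjugate upgrades proportional columns to rank one: adj(g) is a multiple of w
  -- wᵀ.
  have key : ∀ a b, w c ^ 2 * g.adjugate a b = g.adjugate c c * (w a * w b) := fun a b => by
    have e1 := adjugate_mul_apply_comm hw a b c
    have e2 := adjugate_mul_apply_comm hw b c c
    rw [hs c b] at e1
    linear_combination w c * e1 + w a * e2
  have : w c ^ 2 * ∑ i, ∑ j, g.adjugate j i * h i j = 0 := by
    calc _ = g.adjugate c c * ∑ i, ∑ j, w i * w j * h i j := by
          simp only [Finset.mul_sum]
          refine Finset.sum_congr rfl fun i _ => Finset.sum_congr rfl fun j _ => ?_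
          linear_combination h i j * key j i
      _ = 0 := by rw [hh, mul_zero]
  exact (mul_eq_zero.mp this).resolve_left (pow_ne_zero 2 hc)

end Adjugate

/-- The adjugate of a singular symmetric matrix is proportional to w wᵀ, so pairing it with h gives
a multiple of h(w, w). -/
theorem detDeriv_eq_zero {k : Type*} [Field k] {g h : Fin 4 → Fin 4 → k} {w : Fin 4 → k}
    (hg : ∀ i j, g i j = g j i) (hw : ∀ i, ∑ j, g i j * w j = 0) (hw0 : w ≠ 0)
    (hh : ∑ i, ∑ j, w i * w j * h i j = 0) : detDeriv g h = 0 := by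
  have := sum_adjugate_mul_eq_zero (g := Matrix.of g) (h := Matrix.of h)
    (Matrix.IsSymm.ext fun i j => hg j i) (funext hw) hw0 hh
  simp only [← cofactor_eq_adjugate, Fin.sum_univ_four] at this
  exact this

theorem detFour_eq_zero {k : Type*} [Field k] {g : Fin 4 → Fin 4 → k} {w : Fin 4 → k}
    (hw : ∀ i, ∑ j, g i j * w j = 0) (hw0 : w ≠ 0) : detFour g = 0 := by
  have h0 : (Matrix.of g).det = 0 := Matrix.exists_mulVec_eq_zero_iff.mp ⟨w, hw0, funext hw⟩
  have := congrFun (congrFun (Matrix.mul_adjugate (Matrix.of g)) 0) 0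
  rw [h0, zero_smul, Matrix.mul_apply, Fin.sum_univ_four] at this
  simp only [← cofactor_eq_adjugate] at this
  simp only [detFour, sumFour]
  have e : ∀ i j, Matrix.of g i j = g i j := fun _ _ => rfl
  simp only [e, Matrix.zero_apply] at this
  rw [← this]
  change _ = g 0 0 * cofactor g 0 0 + g 0 1 * cofactor g 0 1 + g 0 2 * cofactor g 0 2
    + g 0 3 * cofactor g 0 3
  ring

/-- The Gram matrix of the net on the chart `λ_1 = 1`, after eliminating four variables; entries
are polynomials in `λ_0` with coefficients polynomials in `λ_2`. -/
def netGram : Fin 4 → Fin 4 → LPoly (LPoly ℤ) :=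
  ![![[],
      [[-3, -11, -6], [2, 15, 11], [11, 7], [-1]],
      [[-5, -17, -7], [5, 14, 13], [6, 9], [5]],
      [[-11, -6, -3], [8, 22, 8], [4, 6], [2]]],
    ![[[-3, -11, -6], [2, 15, 11], [11, 7], [-1]],
      [[184, 392, 446, 242], [38, 288, 176], [18, -8], [-2]],
      [[114, 448, 602, 286], [199, 385, 225], [25, 65], [3]],
      [[57, 419, 557, 176], [190, 311, 163], [28, 41], [-1]]],
    ![[[-5, -17, -7], [5, 14, 13], [6, 9], [5]],
      [[114, 448, 602, 286], [199, 385, 225], [25, 65], [3]],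
      [[136, 582, 800, 338], [202, 516, 286], [154, 166], [20]],
      [[150, 604, 713, 208], [149, 410, 205], [117, 105], [19]]],
    ![[[-11, -6, -3], [8, 22, 8], [4, 6], [2]],
      [[57, 419, 557, 176], [190, 311, 163], [28, 41], [-1]],
      [[150, 604, 713, 208], [149, 410, 205], [117, 105], [19]],
      [[248, 720, 578, 128], [152, 364, 144], [76, 68], [12]]]]

/-- The derivative of `netGram` with respect to `λ_0`. -/
def netGramDerivFst : Fin 4 → Fin 4 → LPoly (LPoly ℤ) :=
  ![![[],
      [[2, 15, 11], [22, 14], [-3]],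
      [[5, 14, 13], [12, 18], [15]],
      [[8, 22, 8], [8, 12], [6]]],
    ![[[2, 15, 11], [22, 14], [-3]],
      [[38, 288, 176], [36, -16], [-6]],
      [[199, 385, 225], [50, 130], [9]],
      [[190, 311, 163], [56, 82], [-3]]],
    ![[[5, 14, 13], [12, 18], [15]],
      [[199, 385, 225], [50, 130], [9]],
      [[202, 516, 286], [308, 332], [60]],
      [[149, 410, 205], [234, 210], [57]]],
    ![[[8, 22, 8], [8, 12], [6]],
      [[190, 311, 163], [56, 82], [-3]],
      [[149, 410, 205], [234, 210], [57]],
      [[152, 364, 144], [152, 136], [36]]]]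

/-- The derivative of `netGram` with respect to `λ_2`. -/
def netGramDerivSnd : Fin 4 → Fin 4 → LPoly (LPoly ℤ) :=
  ![![[],
      [[-11, -12], [15, 22], [7]],
      [[-17, -14], [14, 26], [9]],
      [[-6, -6], [22, 16], [6]]],
    ![[[-11, -12], [15, 22], [7]],
      [[392, 892, 726], [288, 352], [-8]],
      [[448, 1204, 858], [385, 450], [65]],
      [[419, 1114, 528], [311, 326], [41]]],
    ![[[-17, -14], [14, 26], [9]],
      [[448, 1204, 858], [385, 450], [65]],
      [[582, 1600, 1014], [516, 572], [166]],
      [[604, 1426, 624], [410, 410], [105]]],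
    ![[[-6, -6], [22, 16], [6]],
      [[419, 1114, 528], [311, 326], [41]],
      [[604, 1426, 624], [410, 410], [105]],
      [[720, 1156, 384], [364, 288], [68]]]]

/-- The coefficient of the determinant in the Bézout identity modulo seven. -/
def netCoeff : LPoly (LPoly ℤ) :=
    [[-2, 0, 0, -2, 0, -3],
     [-1, 2, 0, 1, 2, 3, -1],
     [3, 1, 1, 0, -2, -2, -2, -3],
     [-2, 2, 2, 1, 1, -1, 1],
     [3, -2, 3, 0, -1, 2, -3, -1],
     [0, -2, 0, -3, -1, -1, -3, -1],
     [1, -3, 3, 3, 1, 0, 1],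
     [0, 0, 0, 0, -2, 2]]

/-- The coefficient of the first partial derivative in the Bézout identity modulo seven. -/
def netCoeffFst : LPoly (LPoly ℤ) :=
    [[-3, 1, -1, 1, 3, 2, 1, -2],
     [3, -3, -1, 2, -1, 1, -1, 3, 3],
     [2, 3, -2, -2, -1, -1, 0, -2, -3],
     [1, 1, -3, -2, 0, -1, -3, 1, 3],
     [2, 2, -1, -3, 1, 3, -3, 2, -1],
     [-1, 2, 1, 1, -3, -2, -3, 1],
     [3, 3, 2, -2, -3, 0, 3, 1],
     [-1, 3, -3, -3, -3, -3, -1],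
     [0, 0, 0, 0, -1, -2]]

/-- The coefficient of the second partial derivative in the Bézout identity modulo seven. -/
def netCoeffSnd : LPoly (LPoly ℤ) :=
    [[3, 1, -3, 2, -2, 3, -3, -2],
     [-2, 0, -1, 3, -3, -2, -2, -3, 3],
     [3, 3, -1, 1, -1, 3, 0, 1],
     [-1, 2, 1, 0, 3, -3, -2, 0, 3],
     [0, -3, -3, 0, 3, 2, -2, 1],
     [-1, -1, 2, 3, 0, -3, -3, 3, 1],
     [1, 0, -1, 0, 0, -3, -1, -1],
     [0, 0, 0, 0, 0, -1, -2],
     [0, 0, 0, 0, 3]]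

/-- The Gram matrix of the pencil `λ_1 = 0`, `λ_0 = 1`, after eliminating four variables. -/
def pencilGram : Fin 4 → Fin 4 → LPoly ℤ :=
  ![![[], [-1, 7, 11], [5, 9, 13], [2, 6, 8]],
    ![[-1, 7, 11], [4, 56, 110, 244, 44, 242], [2, 47, 250, 268, 70, 286], [6, 64, 199, 237, 82, 176]],
    ![[5, 9, 13], [2, 47, 250, 268, 70, 286], [6, 96, 434, 294, 104, 338], [9, 109, 322, 269, 110, 208]],
    ![[2, 6, 8], [6, 64, 199, 237, 82, 176], [9, 109, 322, 269, 110, 208], [20, 136, 254, 226, 96, 128]]]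

/-- The derivative of `pencilGram` with respect to `λ_2`. -/
def pencilGramDeriv : Fin 4 → Fin 4 → LPoly ℤ :=
  ![![[], [7, 22], [9, 26], [6, 16]],
    ![[7, 22], [56, 220, 732, 176, 1210], [47, 500, 804, 280, 1430], [64, 398, 711, 328, 880]],
    ![[9, 26], [47, 500, 804, 280, 1430], [96, 868, 882, 416, 1690], [109, 644, 807, 440, 1040]],
    ![[6, 16], [64, 398, 711, 328, 880], [109, 644, 807, 440, 1040], [136, 508, 678, 384, 640]]]

/-- The coefficient of the determinant in the Bézout identity for the pencil. -/
def pencilCoeff : LPoly ℤ := [-1, 1, -1, 0, -1, -1, -3]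

/-- The coefficient of the derivative in the Bézout identity for the pencil. -/
def pencilCoeffDeriv : LPoly ℤ := [2, 0, 1, 3, 1, 3, -2, 3]

/-- Modulo 7, the constant 1 is a combination of the discriminant and its two partial derivatives:
the discriminant curve is nonsingular on the chart λ_1 = 1. -/
theorem net_certificate :
    List.all (netCoeff * detFour netGram + netCoeffFst * detDeriv netGram netGramDerivFst
      + netCoeffSnd * detDeriv netGram netGramDerivSnd + LPoly.const (LPoly.const (-1)))
        (List.all · fun n => decide (n % 7 = 0)) = true := by
  decide +kernel

/-- On the line λ_1 = 0 one derivative is enough: the discriminant restricted to it has only simple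
roots on λ_0 = 1 modulo 7. -/
theorem pencil_certificate :
    List.all (pencilCoeff * detFour pencilGram
      + pencilCoeffDeriv * detDeriv pencilGram pencilGramDeriv
      + LPoly.const (-1)) (fun n => decide (n % 7 = 0)) = true := by
  decide +kernel

/-! ### Nonsingularity in characteristic seven -/

section CharSeven

variable {k : Type*} [Field k]

theorem intCast_eq_zero_of_mod_seven (h7 : (7 : k) = 0) (n : ℤ)
    (hn : decide (n % 7 = 0) = true) : (n : k) = 0 := by
  obtain ⟨m, rfl⟩ := Int.dvd_of_emod_eq_zero (of_decide_eq_true hn)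
  rw [Int.cast_mul]
  simp [h7]

/-- The determinant of the net and its two partial derivatives have no common zero. -/
theorem net_nonsingular (h7 : (7 : k) = 0) (s t : k)
    (φ : LPoly (LPoly ℤ) → k) (hφ : φ = LPoly.eval (LPoly.eval Int.cast t) s)
    (h : detFour (fun i j => φ (netGram i j)) = 0)
    (h₁ : detDeriv (fun i j => φ (netGram i j)) (fun i j => φ (netGramDerivFst i j)) = 0)
    (h₂ : detDeriv (fun i j => φ (netGram i j)) (fun i j => φ (netGramDerivSnd i j)) = 0) :
    False := by
  have hop : IsOpHom φ := hφ ▸ ((IsOpHom.intCast k).eval t).eval s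
  have key : φ (netCoeff * detFour netGram + netCoeffFst * detDeriv netGram netGramDerivFst
      + netCoeffSnd * detDeriv netGram netGramDerivSnd + LPoly.const (LPoly.const (-1))) = 0 :=
    hφ ▸ LPoly.eval_eq_zero_of_all (φ := LPoly.eval (Int.cast : ℤ → k) t)
      (fun b hb => LPoly.eval_eq_zero_of_all (intCast_eq_zero_of_mod_seven h7) t b hb) s _
      net_certificate
  rw [hop.add, hop.add, hop.add, hop.mul, hop.mul, hop.mul, hop.detFour, hop.detDeriv,
    hop.detDeriv, h, h₁, h₂] at key
  simp [hφ, LPoly.const, LPoly.eval] at key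

/-- The determinant of the pencil is squarefree. -/
theorem pencil_nonsingular (h7 : (7 : k) = 0) (t : k)
    (φ : LPoly ℤ → k) (hφ : φ = LPoly.eval Int.cast t)
    (h : detFour (fun i j => φ (pencilGram i j)) = 0)
    (h₁ : detDeriv (fun i j => φ (pencilGram i j)) (fun i j => φ (pencilGramDeriv i j)) = 0) :
    False := by
  have hop : IsOpHom φ := hφ ▸ (IsOpHom.intCast k).eval t
  have key : φ (pencilCoeff * detFour pencilGram
      + pencilCoeffDeriv * detDeriv pencilGram pencilGramDeriv + LPoly.const (-1)) = 0 :=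
    hφ ▸ LPoly.eval_eq_zero_of_all (intCast_eq_zero_of_mod_seven h7) t _ pencil_certificate
  rw [hop.add, hop.add, hop.mul, hop.mul, hop.detFour, hop.detDeriv, h, h₁] at key
  simp [hφ, LPoly.const, LPoly.eval] at key

/-- A vertex on X of the member (s : 1 : t) would be a singular point of the discriminant curve. -/
theorem net_point_eq_zero (h7 : (7 : k) = 0) (s t : k) (x : Fin 8 → k)
    (hQ : ∀ i, quadVal x i = 0)
    (hA : ∀ j, s * quadGrad x 0 j + quadGrad x 1 j + t * quadGrad x 2 j = 0) : x = 0 := by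
  obtain ⟨x0, x1, x2, x3, x4, x5, x6, x7, rfl⟩ :
      ∃ x0 x1 x2 x3 x4 x5 x6 x7, x = ![x0, x1, x2, x3, x4, x5, x6, x7] :=
    ⟨x 0, x 1, x 2, x 3, x 4, x 5, x 6, x 7, by ext i; fin_cases i <;> rfl⟩
  have e0 := hA 0
  have e1 := hA 1
  have e2 := hA 2
  have e3 := hA 3
  have e4 := hA 4
  have e5 := hA 5
  have e6 := hA 6
  have e7 := hA 7
  have q0 := hQ 0
  have q2 := hQ 2
  simp [quadGrad, quadVal] at e0 e1 e2 e3 e4 e5 e6 e7 q0 q2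
  -- The monomials x_0x_2 and x_1x_4 occur only in Q_1, with coefficients -1 and 1, so with λ_1 = 1
  -- the derivatives in x_0 and x_1 can be solved for x_2 and x_4.
  obtain rfl : x2 = s * x3 + (s + 3 + 11 * t) * x5 + (2 * s + 7 + 13 * t) * x6
      + (3 * s + 11 + 8 * t) * x7 := by linear_combination -e0
  obtain rfl : x4 = t * x3 - (-s + 9 + 6 * t) * x5 - (5 * s + 4 + 7 * t) * x6
      - (2 * s + 1 + 3 * t) * x7 := by linear_combination e1
  by_contra hx
  have hw0 : ![x3, x5, x6, x7] ≠ 0 := by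
    intro h
    have h3 : x3 = 0 := congrFun h 0
    have h5 : x5 = 0 := congrFun h 1
    have h6 : x6 = 0 := congrFun h 2
    have h7' : x7 = 0 := congrFun h 3
    subst h3 h5 h6 h7'
    have h0 : x0 = 0 := by linear_combination -e2
    have h1 : x1 = 0 := by linear_combination e4
    subst h0 h1
    exact hx (by ext i; fin_cases i <;> simp)
  -- The multipliers of `e2` and `e4` are the coefficients with which x_2 and x_4 depend on the
  -- remaining variable, by the chain rule; x_0 and x_1 then cancel.
  have hw : ∀ i, ∑ j, LPoly.eval (LPoly.eval Int.cast t) s (netGram i j) *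
      ![x3, x5, x6, x7] j = 0 := by
    intro i
    fin_cases i <;> simp [netGram, LPoly.eval, Fin.sum_univ_four]
    · linear_combination (s) * e2 + (1) * e3 + (t) * e4
    · linear_combination (3 + 11 * t + s) * e2 + (-9 - 6 * t + s) * e4 + (1) * e5
    · linear_combination (7 + 13 * t + 2 * s) * e2 + (-4 - 7 * t - 5 * s) * e4 + (1) * e6
    · linear_combination (11 + 8 * t + 3 * s) * e2 + (-1 - 3 * t - 2 * s) * e4 + (1) * e7
  refine net_nonsingular h7 s t _ rfl (detFour_eq_zero hw hw0)
    (detDeriv_eq_zero ?_ hw hw0 ?_) (detDeriv_eq_zero ?_ hw hw0 ?_)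
  · intro i j; fin_cases i <;> fin_cases j <;> rfl
  -- The s-derivative of the restricted form at w is 2Q_0(x), up to terms from the dependence of x_2
  -- and x_4 on s; these are multiples of `e2` and `e4`. The t-derivative behaves likewise with Q_2.
  · simp [netGramDerivFst, LPoly.eval, Fin.sum_univ_four]
    linear_combination 2 * q0 + 2 * (x3 + x5 + 2 * x6 + 3 * x7) * e2
      - 2 * (-x5 + 5 * x6 + 2 * x7) * e4
  · intro i j; fin_cases i <;> fin_cases j <;> rfl
  · simp [netGramDerivSnd, LPoly.eval, Fin.sum_univ_four]
    linear_combination 2 * q2 + 2 * (11 * x5 + 13 * x6 + 8 * x7) * e2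
      + 2 * (x3 - 6 * x5 - 7 * x6 - 3 * x7) * e4

theorem pencil_point_eq_zero (h7 : (7 : k) = 0) (t : k) (x : Fin 8 → k)
    (hQ : ∀ i, quadVal x i = 0)
    (hA : ∀ j, quadGrad x 0 j + t * quadGrad x 2 j = 0) : x = 0 := by
  obtain ⟨x0, x1, x2, x3, x4, x5, x6, x7, rfl⟩ :
      ∃ x0 x1 x2 x3 x4 x5 x6 x7, x = ![x0, x1, x2, x3, x4, x5, x6, x7] :=
    ⟨x 0, x 1, x 2, x 3, x 4, x 5, x 6, x 7, by ext i; fin_cases i <;> rfl⟩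
  have e0 := hA 0
  have e1 := hA 1
  have e2 := hA 2
  have e3 := hA 3
  have e4 := hA 4
  have e5 := hA 5
  have e6 := hA 6
  have e7 := hA 7
  have q2 := hQ 2
  simp [quadGrad, quadVal] at e0 e1 e2 e3 e4 e5 e6 e7 q2
  -- With λ_1 = 0 and λ_0 = 1, the derivatives in x_0, x_4, x_2, x_3 have constant unit coefficients
  -- at x_3, x_2, x_4, x_0, so they can be solved in this order.
  obtain rfl : x3 = (-1 - 11 * t) * x5
      + (-2 - 13 * t) * x6
      + (-3 - 8 * t) * x7 := by
    linear_combination e0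
  obtain rfl : x2 = (t + 11 * t ^ 2) * x5
      + (-1 + 2 * t + 13 * t ^ 2) * x6
      + (3 * t + 8 * t ^ 2) * x7 := by
    linear_combination -e4
  obtain rfl : x4 = (2 + 11 * t + 2 * t ^ 2 + 22 * t ^ 3) * x5
      + (2 + 11 * t + 4 * t ^ 2 + 26 * t ^ 3) * x6
      + (3 + 13 * t + 6 * t ^ 2 + 16 * t ^ 3) * x7 := by
    linear_combination -e2
  obtain rfl : x0 = (t) * x1
      + (2 + 16 * t + 22 * t ^ 2 + 2 * t ^ 3 + 22 * t ^ 4) * x5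
      + (3 + 30 * t + 24 * t ^ 2 + 4 * t ^ 3 + 26 * t ^ 4) * x6
      + (6 + 22 * t + 21 * t ^ 2 + 6 * t ^ 3 + 16 * t ^ 4) * x7 := by
    linear_combination e3
  by_contra hx
  have hw0 : ![x1, x5, x6, x7] ≠ 0 := by
    intro h
    have h1 : x1 = 0 := congrFun h 0
    have h5 : x5 = 0 := congrFun h 1
    have h6 : x6 = 0 := congrFun h 2
    have h7' : x7 = 0 := congrFun h 3
    subst h1 h5 h6 h7'
    exact hx (by ext i; fin_cases i <;> simp)
  have hw : ∀ i, ∑ j, LPoly.eval Int.cast t (pencilGram i j) * ![x1, x5, x6, x7] j = 0 := by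
    intro i
    fin_cases i <;> simp [pencilGram, LPoly.eval, Fin.sum_univ_four]
    · linear_combination e1
    · linear_combination e5
    · linear_combination e6
    · linear_combination e7
  refine pencil_nonsingular h7 t _ rfl (detFour_eq_zero hw hw0) (detDeriv_eq_zero ?_ hw hw0 ?_)
  · intro i j; fin_cases i <;> fin_cases j <;> rfl
  · simp [pencilGramDeriv, LPoly.eval, Fin.sum_univ_four]
    -- No correction terms appear: the derivatives in the eliminated variables now vanish
    -- identically.
    linear_combination 2 * q2

end CharSeven

/-! ### Nonsingularity over the complex numbers -/

/-- The third quadric is nonsingular. -/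
theorem eq_zero_of_quadGrad_two_eq_zero {k : Type*} [Field k] (h : (18647 : k) ≠ 0)
    (x : Fin 8 → k) (hA : ∀ j, quadGrad x 2 j = 0) : x = 0 := by
  have e0 := hA 0
  have e1 := hA 1
  have e2 := hA 2
  have e3 := hA 3
  have e4 := hA 4
  have e5 := hA 5
  have e6 := hA 6
  have e7 := hA 7
  simp only [quadGrad, Matrix.cons_val] at e0 e1 e2 e3 e4 e5 e6 e7
  ext i
  -- The number 18647 clears the denominators of the inverse of the matrix of the polar form of Q_2;
  -- the coefficients below are the rows of 18647 times that inverse.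
  refine (mul_eq_zero.mp (?_ : 18647 * x i = 0)).resolve_left h
  fin_cases i
  · change 18647 * x 0 = 0
    linear_combination -33422 * e0 + 64970 * e1 - 19070 * e2 - 72647 * e4 - 853 * e5 - 2538 * e6 + 7628 * e7
  · change 18647 * x 1 = 0
    linear_combination 64970 * e0 - 128502 * e1 + 35330 * e2 + 148005 * e4 + 2167 * e5 + 6863 * e6 - 14132 * e7
  · change 18647 * x 2 = 0
    linear_combination -19070 * e0 + 35330 * e1 + 9336 * e2 - 36095 * e4 - 85 * e5 + 75 * e6 - 5 * e7
  · change 18647 * x 3 = 0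
    linear_combination -18647 * e4
  · change 18647 * x 4 = 0
    linear_combination -72647 * e0 + 148005 * e1 - 36095 * e2 - 18647 * e3 - 120690 * e4 + 3035 * e5 - 11453 * e6 + 14438 * e7
  · change 18647 * x 5 = 0
    linear_combination -853 * e0 + 2167 * e1 - 85 * e2 + 3035 * e4 + 578 * e5 - 510 * e6 + 34 * e7
  · change 18647 * x 6 = 0
    linear_combination -2538 * e0 + 6863 * e1 + 75 * e2 - 11453 * e4 - 510 * e5 + 450 * e6 - 30 * e7
  · change 18647 * x 7 = 0
    linear_combination 7628 * e0 - 14132 * e1 - 5 * e2 + 14438 * e4 + 34 * e5 - 30 * e6 + 2 * e7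

/-- The plane of λ is split into the chart λ_1 ≠ 0, the affine line λ_1 = 0 ≠ λ_0, and the point (0
: 0 : 1). -/
theorem point_eq_zero_of_seven_eq_zero {k : Type*} [Field k] (h7 : (7 : k) = 0)
    {l : Fin 3 → k} (hl : l ≠ 0) {x : Fin 8 → k} (hQ : ∀ i, quadVal x i = 0)
    (hA : ∀ j, ∑ i, l i * quadGrad x i j = 0) : x = 0 := by
  simp only [Fin.sum_univ_three] at hA
  by_cases h1 : l 1 = 0
  · by_cases h0 : l 0 = 0
    · have h2 : l 2 ≠ 0 := fun h2 => hl (by ext i; fin_cases i <;> assumption)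
      refine eq_zero_of_quadGrad_two_eq_zero (fun h => one_ne_zero (α := k) ?_) x fun j => ?_
      -- 18647 = 7 · 2664 - 1 is a unit modulo 7.
      · linear_combination 2664 * h7 - h
      · have := hA j
        rw [h0, h1, zero_mul, zero_mul, zero_add, zero_add] at this
        exact (mul_eq_zero.mp this).resolve_left h2
    · refine pencil_point_eq_zero h7 (l 2 / l 0) x hQ fun j => ?_
      have := hA j
      field_simp
      linear_combination this - quadGrad x 1 j * h1
  · refine net_point_eq_zero h7 (l 0 / l 1) (l 2 / l 1) x hQ fun j => ?_
    have := hA j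
    field_simp
    linear_combination this

/-- The quadrics of the net have no singular point in common position: the intersection of the
three quadrics satisfies the Jacobian criterion at every point. -/
theorem point_eq_zero {l : Fin 3 → ℂ} (hl : l ≠ 0) {x : Fin 8 → ℂ}
    (hQ : ∀ i, quadVal x i = 0) (hA : ∀ j, ∑ i, l i * quadGrad x i j = 0) : x = 0 := by
  by_contra hx
  obtain ⟨V, hV⟩ := exists_valuationSubring_residueField_natCast_eq_zero ℂ 7 (by norm_num)
  obtain ⟨c, l', hl', i₀, hi₀⟩ := exists_smul_mem_valuationSubring V hl
  obtain ⟨d, x', hx', j₀, hj₀⟩ := exists_smul_mem_valuationSubring V hx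
  have hinj : Function.Injective V.subtype := Subtype.val_injective
  have hxe : (fun j => V.subtype (x' j)) = fun j => d * x j := funext hx'
  let f := IsLocalRing.residue V
  -- Both vectors were normalized to have an entry 1, so their residues are nonzero, and all
  -- equations persist because they are homogeneous in l and in x.
  have key := point_eq_zero_of_seven_eq_zero (k := IsLocalRing.ResidueField V)
    (by exact_mod_cast hV) (l := fun i => f (l' i)) (x := fun j => f (x' j))
    (fun h => by simpa [hi₀] using congrFun h i₀)
    (fun i => by
      rw [← map_quadVal]
      have : quadVal x' i = 0 := hinj (by
        rw [map_quadVal, hxe, quadVal_smul, hQ i, mul_zero, map_zero])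
      rw [this, map_zero])
    (fun j => by
      simp only [← map_quadGrad, ← map_mul, ← map_sum]
      have : ∑ i, l' i * quadGrad x' i j = 0 := hinj (by
        simp only [map_sum, map_mul, map_quadGrad, hxe, quadGrad_smul]
        have hc : ∀ i, V.subtype (l' i) = c * l i := hl'
        calc _ = c * d * ∑ i, l i * quadGrad x i j := by
              rw [Finset.mul_sum]
              exact Finset.sum_congr rfl fun i _ => by rw [hc]; ring
          _ = _ := by rw [hA j, mul_zero, map_zero])
      rw [this, map_zero])
  simpa [hj₀] using congrFun key j₀

/-! ### The quadric surface bundle -/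

section Bundle

/-! ### Polar forms of the members of the net. -/

section Bilinear

variable {R : Type*} [CommRing R]

theorem quadGrad_add (x x' : Fin 8 → R) (i : Fin 3) (j : Fin 8) :
    quadGrad (x + x') i j = quadGrad x i j + quadGrad x' i j := by
  fin_cases i <;> fin_cases j <;> simp [quadGrad] <;> ring

theorem quadGrad_smul' (c : R) (x : Fin 8 → R) (i : Fin 3) (j : Fin 8) :
    quadGrad (c • x) i j = c * quadGrad x i j :=
  quadGrad_smul c x i j

theorem sum_quadGrad_mul_comm (x x' : Fin 8 → R) (i : Fin 3) :
    ∑ j, quadGrad x i j * x' j = ∑ j, quadGrad x' i j * x j := by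
  fin_cases i <;> simp [quadGrad, Fin.sum_univ_eight] <;> ring

/-- The polar form of the member of the net with coefficients `l`. -/
def netBilin (l : Fin 3 → R) : LinearMap.BilinForm R (Fin 8 → R) :=
  LinearMap.mk₂ R (fun x x' => ∑ i, l i * ∑ j, quadGrad x i j * x' j)
    (fun x₁ x₂ x' => by
      simp only [quadGrad_add, add_mul, Finset.sum_add_distrib, mul_add])
    (fun c x x' => by
      simp only [quadGrad_smul', smul_eq_mul, Finset.mul_sum, mul_assoc, mul_left_comm c])
    (fun x x₁ x₂ => by
      simp only [Pi.add_apply, mul_add, Finset.sum_add_distrib])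
    (fun c x x' => by
      simp only [Pi.smul_apply, smul_eq_mul, Finset.mul_sum, mul_left_comm _ c])

theorem netBilin_apply (l : Fin 3 → R) (x x' : Fin 8 → R) :
    netBilin l x x' = ∑ i, l i * ∑ j, quadGrad x i j * x' j := rfl

theorem netBilin_comm (l : Fin 3 → R) (x x' : Fin 8 → R) :
    netBilin l x x' = netBilin l x' x := by
  simp only [netBilin_apply, sum_quadGrad_mul_comm x x']

theorem netBilin_self (l : Fin 3 → R) (x : Fin 8 → R) :
    netBilin l x x = 2 * ∑ i, l i * quadVal x i := by
  simp only [netBilin_apply, sum_quadGrad_mul, Finset.mul_sum, mul_left_comm (2 : R)]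

theorem netBilin_single (l : Fin 3 → R) (x : Fin 8 → R) (j : Fin 8) :
    netBilin l x (Pi.single j 1) = ∑ i, l i * quadGrad x i j := by
  simp [netBilin_apply, Pi.single_apply]

theorem single_eq_smul {n : Type*} [DecidableEq n] (j : n) (c : R) :
    (Pi.single j c : n → R) = c • Pi.single j 1 := by
  ext i; simp [Pi.single_apply]

/-- The matrix of the polar form of the member of the net with coefficients `l`. -/
def netMatrix (l : Fin 3 → R) : Matrix (Fin 8) (Fin 8) R :=
  Matrix.of fun i j => ∑ k, l k * quadGrad (Pi.single j 1) k i

theorem netMatrix_mulVec (l : Fin 3 → R) (x : Fin 8 → R) (i : Fin 8) :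
    (netMatrix l).mulVec x i = ∑ k, l k * quadGrad x k i := by
  rw [← netBilin_single, netBilin_comm]
  conv_rhs => rw [← Finset.univ_sum_single x]
  rw [map_sum]
  change ∑ j, netMatrix l i j * x j = _
  refine Finset.sum_congr rfl fun j _ => ?_
  rw [single_eq_smul j (x j), map_smul, netBilin_comm, netBilin_single, smul_eq_mul, mul_comm]
  rfl

end Bilinear

/-- The inclusion of `ℂ⁶` as the last six coordinates of `ℂ⁸`. -/
def pad : (Fin 6 → ℂ) →ₗ[ℂ] (Fin 8 → ℂ) where
  toFun y := ![0, 0, y 0, y 1, y 2, y 3, y 4, y 5]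
  map_add' y y' := by ext i; fin_cases i <;> simp
  map_smul' c y := by ext i; fin_cases i <;> simp

/-- The two linear forms on `ℂ⁶` cutting out the three-space of planes through the line that are
tangent to the member of the net with coefficients `l` along the line. -/
def tangentForm (l : Fin 3 → ℂ) (a : Fin 2) : (Fin 6 → ℂ) →ₗ[ℂ] ℂ :=
  (netBilin l (Pi.single (Fin.castAdd 6 a) 1)).comp pad

/-- The linear subspace containing the fibre of the bundle over `l`. -/
def fiberSpace (l : Fin 3 → ℂ) : Submodule ℂ (Fin 6 → ℂ) :=
  LinearMap.ker (LinearMap.pi (tangentForm l))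

theorem mem_fiberSpace {l : Fin 3 → ℂ} {y : Fin 6 → ℂ} :
    y ∈ fiberSpace l ↔ ∀ a, tangentForm l a y = 0 := by
  simp [fiberSpace, funext_iff]

/-- The quadratic form defining the fibre of the bundle over `l`. -/
def fiberForm (l : Fin 3 → ℂ) : QuadraticForm ℂ (fiberSpace l) :=
  (LinearMap.BilinMap.toQuadraticMap (netBilin l)).comp (pad.comp (fiberSpace l).subtype)

theorem fiberForm_apply (l : Fin 3 → ℂ) (w : fiberSpace l) :
    fiberForm l w = 2 * ∑ i, l i * quadVal (pad w) i := netBilin_self l _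

/-- A vector is determined by the last six coordinates and the first two. -/
theorem eq_sum_add_pad (x : Fin 8 → ℂ) :
    x = ∑ a : Fin 2, x (Fin.castAdd 6 a) • Pi.single (Fin.castAdd 6 a) 1
      + pad fun j => x (Fin.natAdd 2 j) := by
  ext i
  fin_cases i <;> simp [pad, Fin.sum_univ_two]

theorem netBilin_line (l : Fin 3 → ℂ) (a b : Fin 2) :
    netBilin l (Pi.single (Fin.castAdd 6 a) 1) (Pi.single (Fin.castAdd 6 b) 1) = 0 := by
  rw [netBilin_single]
  fin_cases a <;> fin_cases b <;> simp [quadGrad, Fin.sum_univ_three]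

/-- A vector annihilated by the polar form of a member of the net. -/
theorem sum_quadGrad_eq_zero {l : Fin 3 → ℂ} {x : Fin 8 → ℂ}
    (h₁ : ∀ a : Fin 2, netBilin l x (Pi.single (Fin.castAdd 6 a) 1) = 0)
    (h₂ : ∀ y, netBilin l x (pad y) = 0) (j : Fin 8) : ∑ i, l i * quadGrad x i j = 0 := by
  rw [← netBilin_single, eq_sum_add_pad (Pi.single j 1), map_add, map_sum, h₂, add_zero]
  simp [h₁]

/-- Six minus two: the two tangency conditions are independent because X is nonsingular along ℓ. -/
theorem finrank_fiberSpace {l : Fin 3 → ℂ} (hl : l ≠ 0) :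
    Module.finrank ℂ (fiberSpace l) = 4 := by
  have hr : LinearMap.range (LinearMap.pi (tangentForm l)) = ⊤ := by
    by_contra h
    obtain ⟨g, hg, hgr⟩ := Submodule.exists_le_ker_of_lt_top _ (lt_top_iff_ne_top.mpr h)
    -- A linear relation g between the two conditions is a point of ℓ, hence of X, at which the
    -- member l is singular.
    let x : Fin 8 → ℂ := ∑ a : Fin 2, g (Pi.single a 1) • Pi.single (Fin.castAdd 6 a) 1
    have hx : x = 0 := by
      refine point_eq_zero hl (fun i => ?_) (sum_quadGrad_eq_zero (fun b => ?_) fun y => ?_)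
      · fin_cases i <;> simp [x, quadVal, Fin.sum_univ_two]
      · simp only [x, map_sum, map_smul, LinearMap.sum_apply, LinearMap.smul_apply]
        exact Finset.sum_eq_zero fun a _ =>
          (congrArg _ (netBilin_line l a b)).trans (smul_zero _)
      · have h0 := hgr ⟨y, rfl⟩
        rw [LinearMap.mem_ker, ← Finset.univ_sum_single (LinearMap.pi (tangentForm l) y)] at h0
        rw [map_sum] at h0
        simp only [x, map_sum, map_smul, LinearMap.sum_apply, LinearMap.smul_apply]
        rw [← h0]
        refine Finset.sum_congr rfl fun a _ => ?_
        rw [single_eq_smul a (LinearMap.pi (tangentForm l) y a), map_smul, smul_eq_mul,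
          smul_eq_mul, mul_comm]
        rfl
    refine hg (LinearMap.pi_ext' fun a => LinearMap.ext_ring ?_)
    have := congrFun hx (Fin.castAdd 6 a)
    fin_cases a <;> simpa [x, Fin.sum_univ_two, Pi.single_apply] using this
  have := LinearMap.finrank_range_add_finrank_ker (LinearMap.pi (tangentForm l))
  rw [hr, finrank_top] at this
  have h26 : 2 + Module.finrank ℂ (fiberSpace l) = 6 :=
    (congrArg (· + _) (Module.finrank_fin_fun ℂ).symm).trans
      (this.trans (Module.finrank_fin_fun ℂ))
  omega

/-- Linear coordinates on the plane spanned by the line and a point. -/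
def planeParam (y : Fin 6 → ℂ) : (Fin 3 → ℂ) →ₗ[ℂ] (Fin 8 → ℂ) where
  toFun u := ![u 0, u 1, u 2 * y 0, u 2 * y 1, u 2 * y 2, u 2 * y 3, u 2 * y 4, u 2 * y 5]
  map_add' u u' := by ext i; fin_cases i <;> simp [add_mul]
  map_smul' c u := by ext i; fin_cases i <;> simp [mul_assoc]

theorem planeThrough_eq_range (y : Fin 6 → ℂ) :
    planeThrough y = LinearMap.range (planeParam y) := by
  apply le_antisymm
  · refine sup_le (fun v hv => ⟨![v 0, v 1, 0], ?_⟩) ?_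
    · have h : ∀ j : Fin 6, v (Fin.natAdd 2 j) = 0 := hv
      have h0 := h 0
      have h1 := h 1
      have h2 := h 2
      have h3 := h 3
      have h4 := h 4
      have h5 := h 5
      ext i
      fin_cases i
      · rfl
      · rfl
      all_goals simp [planeParam]; symm; assumption
    · rw [Submodule.span_singleton_le_iff_mem]
      exact ⟨![0, 0, 1], by ext i; fin_cases i <;> simp [planeParam]⟩
  · rintro _ ⟨u, rfl⟩
    refine Submodule.mem_sup.mpr ⟨![u 0, u 1, 0, 0, 0, 0, 0, 0], ?_,
      u 2 • ![0, 0, y 0, y 1, y 2, y 3, y 4, y 5],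
      Submodule.smul_mem _ _ (Submodule.mem_span_singleton_self _), ?_⟩
    · intro j; fin_cases j <;> rfl
    · ext i; fin_cases i <;> simp [planeParam]

theorem finrank_planeThrough {y : Fin 6 → ℂ} (hy : y ≠ 0) :
    Module.finrank ℂ (planeThrough y) = 3 := by
  rw [planeThrough_eq_range, LinearMap.finrank_range_of_inj, Module.finrank_fin_fun]
  rw [← LinearMap.ker_eq_bot, LinearMap.ker_eq_bot']
  intro u hu
  have h0 : u 0 = 0 := congrFun hu 0
  have h1 : u 1 = 0 := congrFun hu 1
  have h2 : u 2 = 0 := by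
    by_contra h2
    refine hy (funext fun j => (mul_eq_zero.mp ?_).resolve_left h2)
    have := congrFun hu (Fin.natAdd 2 j)
    fin_cases j <;> exact this
  ext i; fin_cases i <;> assumption

/-- The factor u_2 reflects that ℓ lies in every member. The residual line is the whole plane
exactly when both tangency forms and the value at y vanish. -/
theorem sum_quadVal_planeParam (l : Fin 3 → ℂ) (y : Fin 6 → ℂ) (u : Fin 3 → ℂ) :
    ∑ i, l i * quadVal (planeParam y u) i
      = u 2 * (u 0 * tangentForm l 0 y + u 1 * tangentForm l 1 y)
        + u 2 ^ 2 * ∑ i, l i * quadVal (pad y) i := by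
  have h : ∀ a, tangentForm l a y = ∑ i, l i * quadGrad (pad y) i (Fin.castAdd 6 a) := fun a => by
    rw [← netBilin_single, netBilin_comm]; rfl
  rw [h, h]
  simp [quadVal, quadGrad, pad, planeParam, Fin.sum_univ_three]
  ring

theorem mem_quadricBundle {l : ℙ ℂ (Fin 3 → ℂ)} {y : Fin 6 → ℂ} (hy : y ≠ 0) :
    (l, planeThrough y) ∈ quadricBundle ↔
      y ∈ fiberSpace l.rep ∧ ∑ i, l.rep i * quadVal (pad y) i = 0 := by
  have h1 : (l, planeThrough y) ∈ quadricBundle ↔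
      ∀ u, ∑ i, l.rep i * quadVal (planeParam y u) i = 0 := by
    refine ⟨fun h u => ?_, fun h => ⟨finrank_planeThrough hy, le_sup_left, fun v hv => ?_⟩⟩
    · simpa only [eval_quadric] using
        h.2.2 (planeParam y u) ((planeThrough_eq_range y).ge ⟨u, rfl⟩)
    · obtain ⟨u, rfl⟩ := (planeThrough_eq_range y).le hv
      simpa only [eval_quadric] using h u
  rw [h1, mem_fiberSpace]
  simp only [sum_quadVal_planeParam]
  refine ⟨fun h => ?_, fun h u => by rw [h.1, h.1, h.2]; ring⟩
  -- These three values isolate the three coefficients of the residual linear form.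
  have e1 := h ![0, 0, 1]
  have e2 := h ![1, 0, 1]
  have e3 := h ![0, 1, 1]
  simp at e1 e2 e3
  rw [e1, add_zero] at e2 e3
  exact ⟨Fin.forall_fin_two.mpr ⟨e2, e3⟩, e1⟩

theorem isQuadricIn_bundleFiber (l : ℙ ℂ (Fin 3 → ℂ)) :
    IsQuadricIn (bundleFiber l) (fiberSpace l.rep) (fiberForm l.rep) := by
  refine ⟨finrank_fiberSpace l.rep_nonzero, fun y => ?_⟩
  change (l, planeThrough y.rep) ∈ quadricBundle ↔ _
  rw [mem_quadricBundle y.rep_nonzero]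
  simp [fiberForm_apply]

/-- If the form vanished, so would its polar form; evaluating on explicit vectors of the fibre
space, separately for l_1 = 0 and l_1 ≠ 0, forces a contradiction. -/
theorem fiberForm_ne_zero {l : Fin 3 → ℂ} (hl : l ≠ 0) : fiberForm l ≠ 0 := by
  intro h0
  have key : ∀ y y', y ∈ fiberSpace l → y' ∈ fiberSpace l → netBilin l (pad y) (pad y') = 0 := by
    intro y y' hy hy'
    have h : ∀ w : fiberSpace l, netBilin l (pad w) (pad w) = 0 := fun w =>
      DFunLike.congr_fun h0 w
    have e := h (⟨y, hy⟩ + ⟨y', hy'⟩)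
    have e1 := h ⟨y, hy⟩
    have e2 := h ⟨y', hy'⟩
    simp only [Submodule.coe_add, map_add, LinearMap.add_apply] at e e1 e2
    rw [e1, e2, netBilin_comm l (pad y') (pad y)] at e
    linear_combination e / 2
  have hmem : ∀ y : Fin 6 → ℂ, y ∈ fiberSpace l ↔ ∀ a : Fin 2,
      ∑ i, l i * quadGrad (pad y) i (Fin.castAdd 6 a) = 0 := fun y => by
    rw [mem_fiberSpace]
    refine forall_congr' fun a => ?_
    rw [← netBilin_single, netBilin_comm]; rfl
  by_cases h1 : l 1 = 0
  -- For l_1 = 0 the x_2 and x_4 directions lie in the fibre space; their pairings are 2l_2 and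
  -- -l_0.
  · have m0 : (![1, 0, 0, 0, 0, 0] : Fin 6 → ℂ) ∈ fiberSpace l := by
      rw [hmem]; intro a; fin_cases a <;> simp [quadGrad, pad, Fin.sum_univ_three, h1]
    have m2 : (![0, 0, 1, 0, 0, 0] : Fin 6 → ℂ) ∈ fiberSpace l := by
      rw [hmem]; intro a; fin_cases a <;> simp [quadGrad, pad, Fin.sum_univ_three, h1]
    have e0 := key _ _ m0 m0
    have e2 := key _ _ m0 m2
    simp [netBilin_apply, quadGrad, pad, Fin.sum_univ_three, Fin.sum_univ_eight, h1] at e0 e2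
    exact hl (by ext i; fin_cases i <;> assumption)
  -- The first vector is the rational section; the others are fibre directions with only x_6,
  -- respectively x_7, switched on among x_3, x_5, x_6, x_7.
  · have w0 : ![l 0, l 1, l 2, 0, 0, 0] ∈ fiberSpace l := by
      rw [hmem]; intro a
      fin_cases a <;> simp [quadGrad, pad, Fin.sum_univ_three] <;> ring
    have w2 : ![2 * l 0 + 7 * l 1 + 13 * l 2, 0, -(5 * l 0 + 4 * l 1 + 7 * l 2), 0, l 1, 0]
        ∈ fiberSpace l := by
      rw [hmem]; intro a
      fin_cases a <;> simp [quadGrad, pad, Fin.sum_univ_three] <;> ring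
    have w3 : ![3 * l 0 + 11 * l 1 + 8 * l 2, 0, -(2 * l 0 + l 1 + 3 * l 2), 0, 0, l 1]
        ∈ fiberSpace l := by
      rw [hmem]; intro a
      fin_cases a <;> simp [quadGrad, pad, Fin.sum_univ_three] <;> ring
    have g02 := key _ _ w0 w2
    have g03 := key _ _ w0 w3
    have g22 := key _ _ w2 w2
    have g23 := key _ _ w2 w3
    have g33 := key _ _ w3 w3
    simp [netBilin_apply, quadGrad, pad, Fin.sum_univ_three, Fin.sum_univ_eight]
      at g02 g03 g22 g23 g33
    -- The five pairings are cubic forms in l, and l_1⁴ is a combination of them with linear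
    -- coefficients.
    have : (l 1) ^ 4 = 0 := by
      linear_combination (-564519774610 / 15364208045041 * l 1
        - 1728498955940 / 15364208045041 * l 2
        - 70550726333 / 15364208045041 * l 0) * g02
        + (-2244673918445 / 30728416090082 * l 1
        + 1081374741795 / 15364208045041 * l 2
        - 307590021769 / 61456832180164 * l 0) * g03
        + (-1500268460507 / 61456832180164 * l 1
        - 195192582966 / 15364208045041 * l 2
        + 360979155913 / 122913664360328 * l 0) * g22
        + (2043062375811 / 61456832180164 * l 1
        + 2068011495411 / 61456832180164 * l 2
        - 114894964399 / 15364208045041 * l 0) * g23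
        + (-819671252101 / 122913664360328 * l 1
        - 2597594044929 / 122913664360328 * l 2
        + 148925423029 / 15364208045041 * l 0) * g33
    exact h1 (pow_eq_zero_iff (by norm_num) |>.mp this)

/-- The discriminant of the net. -/
def netDisc : MvPolynomial (Fin 3) ℂ := (netMatrix (X : Fin 3 → MvPolynomial (Fin 3) ℂ)).det

theorem eval_netDisc (l : Fin 3 → ℂ) : eval l netDisc = (netMatrix l).det := by
  rw [netDisc, RingHom.map_det]
  congr 1
  ext i j
  simp only [RingHom.mapMatrix_apply, Matrix.map_apply, netMatrix, Matrix.of_apply, map_sum,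
    map_mul, eval_X, map_quadGrad]
  refine Finset.sum_congr rfl fun k _ => ?_
  congr 3
  ext a
  simp [Pi.single_apply, apply_ite]

theorem isHomogeneous_netDisc : netDisc.IsHomogeneous 8 := by
  rw [netDisc, Matrix.det_apply]
  refine IsHomogeneous.sum _ _ _ fun σ _ => ?_
  rw [Units.smul_def, zsmul_eq_mul]
  have hc : ∀ n : ℤ, ((n : MvPolynomial (Fin 3) ℂ)).IsHomogeneous 0 := fun n => by
    rw [← map_intCast (C : ℂ →+* MvPolynomial (Fin 3) ℂ)]; exact isHomogeneous_C _ _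
  have h8 : 0 + ∑ _i : Fin 8, 1 = 8 := by simp
  refine (congrArg (fun n => IsHomogeneous (_ : MvPolynomial (Fin 3) ℂ) n) h8).mp ?_
  refine (hc _).mul (IsHomogeneous.prod _ _ _ fun i _ => ?_)
  change (∑ k, X k * quadGrad (Pi.single i 1) k (σ i)).IsHomogeneous (1 + 0)
  refine IsHomogeneous.sum _ _ _ fun k _ => (isHomogeneous_X ℂ k).mul ?_
  have : (Pi.single i 1 : Fin 8 → MvPolynomial (Fin 3) ℂ)
      = fun a => C ((Pi.single i 1 : Fin 8 → ℂ) a) := by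
    funext a
    by_cases h : a = i <;> simp [h]
  rw [this, ← map_quadGrad]
  exact isHomogeneous_C _ _

/-- The discriminant is nonzero at (0 : 0 : 1), because Q_2 is nonsingular. -/
theorem netDisc_ne_zero : netDisc ≠ 0 := by
  intro h
  have h0 : (netMatrix ![0, 0, (1 : ℂ)]).det = 0 := by rw [← eval_netDisc, h, map_zero]
  obtain ⟨v, hv, hv0⟩ := Matrix.exists_mulVec_eq_zero_iff.mpr h0
  refine hv (eq_zero_of_quadGrad_two_eq_zero (by norm_num) v fun j => ?_)
  simpa [netMatrix_mulVec, Fin.sum_univ_three] using congrFun hv0 j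

/-- With L the isotropic plane of ℓ, the fibre space is L^⊥/L. A radical vector of the form there
lifts, after correction by an element of L, to a radical vector of the form on ℂ⁸. -/
theorem nondegenerate_fiberForm {l : Fin 3 → ℂ} (hl : (netMatrix l).det ≠ 0) :
    (QuadraticMap.polarBilin (fiberForm l)).Nondegenerate := by
  have hB : ∀ w w' : fiberSpace l,
      QuadraticMap.polarBilin (fiberForm l) w w' = 2 * netBilin l (pad w) (pad w') := by
    intro w w'
    rw [QuadraticMap.polarBilin_apply_apply, QuadraticMap.polar]
    simp only [fiberForm, QuadraticMap.comp_apply, LinearMap.BilinMap.toQuadraticMap_apply,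
      map_add, LinearMap.add_apply, LinearMap.comp_apply]
    rw [netBilin_comm l (pad ((fiberSpace l).subtype w'))]
    simp only [Submodule.subtype_apply]
    ring
  have key : ∀ w : fiberSpace l, (∀ w' : fiberSpace l, netBilin l (pad w) (pad w') = 0) →
      w = 0 := by
    intro w hw
    -- Pairing with w kills the common kernel of the two tangency forms, so it is a combination of
    -- them.
    have hmem : (netBilin l (pad w)).comp pad ∈ Submodule.span ℂ (Set.range (tangentForm l)) := by
      refine mem_span_of_iInf_ker_le_ker fun y hy => ?_
      rw [Submodule.mem_iInf] at hy
      exact hw ⟨y, mem_fiberSpace.mpr hy⟩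
    obtain ⟨c, hc⟩ := (Submodule.mem_span_range_iff_exists_fun ℂ).mp hmem
    -- Subtracting the same combination of the basis of L makes the pairing with all of ℂ⁸ vanish.
    let x : Fin 8 → ℂ := pad w - ∑ a : Fin 2, c a • Pi.single (Fin.castAdd 6 a) 1
    have hx : x = 0 := by
      by_contra hx
      refine hl (Matrix.exists_mulVec_eq_zero_iff.mp ⟨x, hx, funext fun j => ?_⟩)
      rw [netMatrix_mulVec]
      refine sum_quadGrad_eq_zero (fun b => ?_) (fun y => ?_) j
      · simp only [x, map_sub, map_sum, map_smul, LinearMap.sub_apply, LinearMap.sum_apply,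
          LinearMap.smul_apply]
        rw [netBilin_comm]
        have h1 : netBilin l (Pi.single (Fin.castAdd 6 b) 1) (pad w) = 0 :=
          mem_fiberSpace.mp w.2 b
        rw [h1, zero_sub, neg_eq_zero]
        exact Finset.sum_eq_zero fun a _ =>
          (congrArg _ (netBilin_line l a b)).trans (smul_zero _)
      · have := LinearMap.congr_fun hc y
        simp only [LinearMap.sum_apply, LinearMap.smul_apply] at this
        simp only [x, map_sub, map_sum, map_smul, LinearMap.sub_apply, LinearMap.sum_apply,
          LinearMap.smul_apply]
        rw [sub_eq_zero]
        exact this.symm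
    ext j
    have h1 : pad w (Fin.natAdd 2 j) = (w : Fin 6 → ℂ) j := by fin_cases j <;> rfl
    have h2 : ∀ a : Fin 2,
        (Pi.single (Fin.castAdd 6 a) 1 : Fin 8 → ℂ) (Fin.natAdd 2 j) = 0 := fun a =>
      Pi.single_eq_of_ne (fun h => by
        have h' : 2 + j.val = a.val := congrArg Fin.val h
        have := a.isLt
        omega) _
    have h3 : x (Fin.natAdd 2 j) = 0 := congrFun hx _
    simp only [x, Pi.sub_apply, Finset.sum_apply, Pi.smul_apply, h1] at h3
    rw [Finset.sum_eq_zero fun a _ => (congrArg _ (h2 a)).trans (smul_zero _), sub_zero] at h3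
    exact h3
  constructor
  · intro w hw
    exact key w fun w' => by simpa [hB] using hw w'
  · intro w hw
    exact key w fun w' => by
      have := hw w'
      rw [hB, netBilin_comm] at this
      simpa using this

/-- Substituting (x_2, x_3, x_4) = λ, the coefficients of x_0 and x_1 and the remaining cubic form
in λ cancel identically. -/
theorem isRationalSection_net : IsRationalSection ![X 0, X 1, X 2, 0, 0, 0] := by
  refine ⟨⟨1, fun j => ?_⟩, fun h => X_ne_zero (R := ℂ) (0 : Fin 3) (congrFun h 0), fun l hl => ?_⟩
  · fin_cases j
    · exact isHomogeneous_X ℂ _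
    · exact isHomogeneous_X ℂ _
    · exact isHomogeneous_X ℂ _
    all_goals exact isHomogeneous_zero _ _ _
  · have hs : (fun j => eval l.rep ((![X 0, X 1, X 2, 0, 0, 0] : Fin 6 → MvPolynomial (Fin 3) ℂ) j))
        = ![l.rep 0, l.rep 1, l.rep 2, 0, 0, 0] := by
      ext j; fin_cases j <;> simp
    rw [hs] at hl ⊢
    rw [mem_quadricBundle hl, mem_fiberSpace]
    have h : ∀ y a, tangentForm l.rep a y
        = ∑ i, l.rep i * quadGrad (pad y) i (Fin.castAdd 6 a) := fun y a => by
      rw [← netBilin_single, netBilin_comm]; rfl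
    refine ⟨fun a => ?_, ?_⟩
    · rw [h]
      fin_cases a <;> simp [quadGrad, pad, Fin.sum_univ_three] <;> ring
    · simp [quadVal, pad, Fin.sum_univ_three]
      ring

end Bundle

/-! ### Charts of `Proj` at elements of degree one -/

section Chart

open HomogeneousLocalization

variable {K A : Type*} [CommRing K] [CommRing A] [Algebra K A] (𝒜 : ℕ → Submodule K A)
  [GradedAlgebra 𝒜] {f : A}

theorem mk_self_eq_one (f : A) : Ideal.Quotient.mk (Ideal.span {f - 1}) f = 1 :=
  (Ideal.Quotient.mk_eq_mk_iff_sub_mem f 1).mpr (Ideal.mem_span_singleton_self _)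

theorem isUnit_mk_self (f : A) : IsUnit (Ideal.Quotient.mk (Ideal.span {f - 1}) f) := by
  rw [mk_self_eq_one]
  exact isUnit_one

/-- Dehomogenization: the map from the homogeneous localization at `f` to `A / (f - 1)`. -/
def awayToQuotient (f : A) : Away 𝒜 f →+* A ⧸ Ideal.span {f - 1} :=
  (IsLocalization.Away.lift (S := Localization.Away f) f
    (g := Ideal.Quotient.mk (Ideal.span {f - 1})) (isUnit_mk_self f)).comp (algebraMap (Away 𝒜 f) (Localization.Away f))

theorem awayToQuotient_mk {d : ℕ} (hf : f ∈ 𝒜 d) (n : ℕ) (a : A) (ha : a ∈ 𝒜 (n • d)) :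
    awayToQuotient 𝒜 f (Away.mk 𝒜 hf n a ha) = Ideal.Quotient.mk _ a := by
  have h : algebraMap (Away 𝒜 f) (Localization.Away f) (Away.mk 𝒜 hf n a ha)
      * algebraMap A _ f ^ n = algebraMap A _ a := by
    rw [HomogeneousLocalization.algebraMap_apply, Away.val_mk, ← map_pow,
      Localization.mk_eq_mk']
    exact IsLocalization.mk'_spec _ a (⟨f ^ n, n, rfl⟩ : Submonoid.powers f)
  have h' := congrArg (IsLocalization.Away.lift (S := Localization.Away f) f
    (g := Ideal.Quotient.mk (Ideal.span {f - 1})) (isUnit_mk_self f)) h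
  rw [map_mul, map_pow, IsLocalization.Away.lift_eq, IsLocalization.Away.lift_eq] at h'
  have h₁ : Ideal.Quotient.mk (Ideal.span {f - 1}) f ^ n = 1 := by rw [mk_self_eq_one, one_pow]
  exact ((mul_one _).symm.trans (congrArg _ h₁.symm)).trans h'

theorem awayToQuotient_surjective (hf : f ∈ 𝒜 1) :
    Function.Surjective (awayToQuotient 𝒜 f) := by
  intro x
  obtain ⟨a, rfl⟩ := Ideal.Quotient.mk_surjective x
  change _ ∈ (awayToQuotient 𝒜 f).range
  induction a using DirectSum.Decomposition.inductionOn 𝒜 with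
  | zero => rw [map_zero]; exact zero_mem _
  | @homogeneous n m =>
    exact ⟨Away.mk 𝒜 hf n m (by simp), awayToQuotient_mk 𝒜 hf n _ _⟩
  | add a b ha hb => rw [map_add]; exact add_mem ha hb

/-- Comparing components in a = (f - 1)b gives a recursion: b vanishes below degree n, equals -a in
degree n, and -fᵏa in degree n + k. Since b has finitely many components, some fᵏa is zero. -/
theorem exists_pow_mul_eq_zero {n : ℕ} {a b : A} (hf : f ∈ 𝒜 1) (ha : a ∈ 𝒜 n)
    (hab : a = (f - 1) * b) : ∃ k, f ^ k * a = 0 := by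
  classical
  have hsucc (j : ℕ) : (DirectSum.decompose 𝒜 (f * b) (j + 1) : A)
      = f * DirectSum.decompose 𝒜 b j := by
    rw [add_comm]
    exact DirectSum.coe_decompose_mul_add_of_left_mem 𝒜 hf
  have hzero : (DirectSum.decompose 𝒜 (f * b) 0 : A) = 0 :=
    DirectSum.coe_decompose_mul_of_left_mem_of_not_le 𝒜 hf (by omega)
  have hb : b = f * b - a := by rw [hab]; ring
  have hcomp (j : ℕ) : (DirectSum.decompose 𝒜 b j : A)
      = DirectSum.decompose 𝒜 (f * b) j - DirectSum.decompose 𝒜 a j := by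
    conv_lhs => rw [hb]
    simp [DirectSum.decompose_sub]
  have hlow (j : ℕ) (hj : j < n) : (DirectSum.decompose 𝒜 b j : A) = 0 := by
    induction j with
    | zero => rw [hcomp, hzero, DirectSum.decompose_of_mem_ne 𝒜 ha hj.ne', sub_zero]
    | succ j ih =>
      rw [hcomp, hsucc, ih (by omega), DirectSum.decompose_of_mem_ne 𝒜 ha hj.ne', mul_zero,
        sub_zero]
  have hn : (DirectSum.decompose 𝒜 b n : A) = - a := by
    rw [hcomp, DirectSum.decompose_of_mem_same 𝒜 ha]
    cases n with
    | zero => rw [hzero, zero_sub]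
    | succ n => rw [hsucc, hlow n (by omega), mul_zero, zero_sub]
  have hhigh (k : ℕ) : (DirectSum.decompose 𝒜 b (n + k) : A) = - (f ^ k * a) := by
    induction k with
    | zero => simp [hn]
    | succ k ih =>
      rw [hcomp, ← add_assoc, hsucc, ih, DirectSum.decompose_of_mem_ne 𝒜 ha (by omega)]
      ring
  obtain ⟨k, hk⟩ := Infinite.exists_notMem_finset
    ((DirectSum.decompose 𝒜 b).support.image fun j => j - n)
  refine ⟨k, ?_⟩
  have : DirectSum.decompose 𝒜 b (n + k) = 0 := by
    by_contra h
    exact hk (Finset.mem_image.mpr ⟨n + k, by simpa using h, by omega⟩)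
  rw [← neg_eq_zero, ← hhigh, this, ZeroMemClass.coe_zero]

theorem awayToQuotient_injective (hf : f ∈ 𝒜 1) :
    Function.Injective (awayToQuotient 𝒜 f) := by
  rw [injective_iff_map_eq_zero]
  intro x hx
  obtain ⟨n, a, ha, rfl⟩ := Away.mk_surjective 𝒜 hf x
  rw [awayToQuotient_mk, Ideal.Quotient.eq_zero_iff_mem, Ideal.mem_span_singleton'] at hx
  obtain ⟨b, hb⟩ := hx
  obtain ⟨k, hk⟩ := exists_pow_mul_eq_zero 𝒜 (n := n) hf (by simpa using ha) (by rw [mul_comm]; exact hb.symm)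
  apply HomogeneousLocalization.val_injective
  rw [Away.val_mk, HomogeneousLocalization.val_zero, Localization.mk_eq_mk',
    IsLocalization.mk'_eq_zero_iff]
  exact ⟨⟨f ^ k, k, rfl⟩, hk⟩

/-- The chart of `Proj` at an element `f` of degree one has coordinate ring `A / (f - 1)`. -/
def awayEquivQuotient (hf : f ∈ 𝒜 1) : Away 𝒜 f ≃+* A ⧸ Ideal.span {f - 1} :=
  RingEquiv.ofBijective (awayToQuotient 𝒜 f)
    ⟨awayToQuotient_injective 𝒜 hf, awayToQuotient_surjective 𝒜 hf⟩

/-- Dehomogenization respects scalars, so the chart isomorphism is one over the base. -/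
theorem awayToQuotient_comp_fromZeroRingHom (f : A) :
    ((awayToQuotient 𝒜 f).comp (fromZeroRingHom 𝒜 (Submonoid.powers f))).comp
      (algebraMap K (𝒜 0)) = algebraMap K (A ⧸ Ideal.span {f - 1}) := by
  ext c
  have : fromZeroRingHom 𝒜 (Submonoid.powers f) (algebraMap K (𝒜 0) c)
      = HomogeneousLocalization.mk ⟨0, algebraMap K (𝒜 0) c, 1, one_mem _⟩ := rfl
  simp only [RingHom.comp_apply, awayToQuotient, this]
  rw [HomogeneousLocalization.algebraMap_apply, HomogeneousLocalization.val_mk]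
  simp only [SetLike.GradeZero.coe_one]
  rw [Localization.mk_eq_mk']
  have h1 : (⟨1, one_mem _⟩ : Submonoid.powers f) = 1 := rfl
  erw [h1, IsLocalization.mk'_one, IsLocalization.Away.lift_eq]
  rfl

end Chart

/-! ### The Jacobian criterion -/

section Jacobian

variable {K : Type} [Field K] {ι σ : Type} [Fintype ι] [DecidableEq ι] [Fintype σ]

/-- A matrix with linearly independent rows has a nonvanishing maximal minor. -/
theorem exists_det_submatrix_ne_zero (M : Matrix ι σ K)
    (hM : LinearIndependent K M.row) :
    ∃ a : ι → σ, Function.Injective a ∧ (M.submatrix id a).det ≠ 0 := by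
  classical
  have hrank : Module.finrank K (Submodule.span K (Set.range M.col)) = Fintype.card ι := by
    rw [← Matrix.rank_eq_finrank_span_cols, hM.rank_matrix]
  obtain ⟨κ, b, hb, hspan, hli⟩ := exists_linearIndependent' K M.col
  have : Finite κ := Finite.of_injective b hb
  have : Fintype κ := Fintype.ofFinite κ
  have hcard : Fintype.card κ = Fintype.card ι := by
    rw [← hrank, ← hspan, finrank_span_eq_card hli]
  let e : ι ≃ κ := (Fintype.equivOfCardEq hcard).symm
  refine ⟨b ∘ e, hb.comp e.injective, ?_⟩
  rw [← isUnit_iff_ne_zero, ← Matrix.isUnit_iff_isUnit_det,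
    ← Matrix.linearIndependent_cols_iff_isUnit]
  exact hli.comp e e.injective

variable (v : ι → MvPolynomial σ K)

/-- The minor of the Jacobian matrix of `v` given by the variables `a`. -/
def jacobianMinor (a : ι → σ) : MvPolynomial σ K :=
  Matrix.det (Matrix.of fun i j => pderiv (a i) (v j))

/-- The chosen minor is the Jacobian of the naive presentation. Inverting it adds one generator and
one relation, so the presentation becomes submersive and the relative dimension is unchanged. -/
theorem isStandardSmooth_localization_jacobianMinor (a : ι → σ) (ha : Function.Injective a)
    (T : Type) [CommRing T] [Algebra (MvPolynomial σ K ⧸ Ideal.span (Set.range v)) T]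
    [Algebra K T] [IsScalarTower K (MvPolynomial σ K ⧸ Ideal.span (Set.range v)) T]
    [IsLocalization.Away (Ideal.Quotient.mk (Ideal.span (Set.range v)) (jacobianMinor v a)) T] :
    Algebra.IsStandardSmoothOfRelativeDimension (Fintype.card σ - Fintype.card ι) K T := by
  classical
  let P := Algebra.PreSubmersivePresentation.naive (v := v) a ha
  have hP : P.jacobian = Ideal.Quotient.mk _ (jacobianMinor v a) := by
    rw [P.jacobian_eq_jacobiMatrix_det]
    have : P.jacobiMatrix = Matrix.of fun i j => pderiv (a i) (v j) := by
      ext1 i j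
      simp [P]
    rw [this, Algebra.Generators.algebraMap_apply]
    exact (MvPolynomial.aeval_unique (Ideal.Quotient.mkₐ K (Ideal.span (Set.range v))) ▸ rfl)
  let L := Algebra.PreSubmersivePresentation.localizationAway T
    (Ideal.Quotient.mk (Ideal.span (Set.range v)) (jacobianMinor v a))
  let S : Algebra.SubmersivePresentation K T (Unit ⊕ σ) (Unit ⊕ ι) :=
    { L.comp P with
      jacobian_isUnit := by
        have hu : IsUnit (algebraMap (MvPolynomial σ K ⧸ Ideal.span (Set.range v)) T
          (Ideal.Quotient.mk _ (jacobianMinor v a))) := IsLocalization.Away.algebraMap_isUnit _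
        change IsUnit (L.comp P).jacobian
        rw [Algebra.PreSubmersivePresentation.comp_jacobian_eq_jacobian_smul_jacobian, hP,
          Algebra.smul_def, Algebra.PreSubmersivePresentation.localizationAway_jacobian]
        exact hu.mul hu }
  refine S.isStandardSmoothOfRelativeDimension ?_
  simp only [Algebra.Presentation.dimension, Nat.card_eq_fintype_card, Fintype.card_sum,
    Fintype.card_unit]
  omega

/-- By the Nullstellensatz a maximal ideal containing all minors is a point of the zero locus, where
independence of the gradients leaves some minor nonzero. -/
theorem span_jacobianMinor_eq_top [IsAlgClosed K]
    (h : ∀ x : σ → K, (∀ i, eval x (v i) = 0) →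
      LinearIndependent K fun i j => eval x (pderiv j (v i))) :
    Ideal.span ((fun a => Ideal.Quotient.mk (Ideal.span (Set.range v)) (jacobianMinor v a)) ''
      {a | Function.Injective a}) = ⊤ := by
  by_contra hne
  obtain ⟨m, hm, hle⟩ := Ideal.exists_le_maximal _ hne
  have hm' : (m.comap (Ideal.Quotient.mk (Ideal.span (Set.range v)))).IsMaximal :=
    Ideal.comap_isMaximal_of_surjective _ Ideal.Quotient.mk_surjective
  obtain ⟨x, hx⟩ := isMaximal_iff_eq_vanishingIdeal_singleton.mp hm'
  have hmem (p : MvPolynomial σ K) : Ideal.Quotient.mk _ p ∈ m ↔ eval x p = 0 := by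
    rw [← Ideal.mem_comap, hx, mem_vanishingIdeal_singleton_iff]
    exact Iff.rfl
  obtain ⟨a, ha, hdet⟩ := exists_det_submatrix_ne_zero
    (Matrix.of fun i j => eval x (pderiv j (v i))) (h x fun i => by
      have h0 : Ideal.Quotient.mk (Ideal.span (Set.range v)) (v i) = 0 :=
        Ideal.Quotient.eq_zero_iff_mem.mpr (Ideal.subset_span ⟨i, rfl⟩)
      rw [← hmem, h0]
      exact zero_mem m)
  apply hdet
  rw [← Matrix.det_transpose]
  have := (hmem _).mp (hle (Ideal.subset_span ⟨a, ha, rfl⟩))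
  rw [jacobianMinor, RingHom.map_det] at this
  exact this

theorem locally_isStandardSmooth_quotient [IsAlgClosed K]
    (h : ∀ x : σ → K, (∀ i, eval x (v i) = 0) →
      LinearIndependent K fun i j => eval x (pderiv j (v i))) :
    RingHom.Locally (RingHom.IsStandardSmoothOfRelativeDimension
      (Fintype.card σ - Fintype.card ι))
      (algebraMap K (MvPolynomial σ K ⧸ Ideal.span (Set.range v))) := by
  refine ⟨_, span_jacobianMinor_eq_top v h, ?_⟩
  rintro _ ⟨a, ha, rfl⟩
  rw [← IsScalarTower.algebraMap_eq, RingHom.isStandardSmoothOfRelativeDimension_algebraMap]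
  exact isStandardSmooth_localization_jacobianMinor v a ha _

end Jacobian

/-! ### Affine charts of the fourfold -/

/-- The equations of the fourfold in the affine chart `x_i = 1`. -/
def chartEqs (i : Fin 8) : Fin 4 → MvPolynomial (Fin 8) ℂ := Fin.cons (X i - 1) quadric

/-- The coordinate ring of the affine chart `x_i = 1`. -/
abbrev ChartRing (i : Fin 8) : Type :=
  MvPolynomial (Fin 8) ℂ ⧸ Ideal.span (Set.range (chartEqs i))

theorem span_chartEqs (i : Fin 8) :
    idealX.toIdeal ⊔ Ideal.span {X i - 1} = Ideal.span (Set.range (chartEqs i)) := by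
  rw [chartEqs, Fin.range_cons, Ideal.span_insert, sup_comm]
  rfl

/-- The residue class of the coordinate `x_i`. -/
abbrev coord (i : Fin 8) : MvPolynomial (Fin 8) ℂ ⧸ idealX.toIdeal :=
  Ideal.Quotient.mk idealX.toIdeal (X i)

theorem coord_mem (i : Fin 8) : coord i ∈ quotGrading idealX 1 :=
  mk_mem_quotGrading idealX (isHomogeneous_X ℂ i)

/-- Setting `x_i = 1` and dividing by the ideal of the fourfold can be done in either order. -/
def quotCoordEquiv (i : Fin 8) :
    ((MvPolynomial (Fin 8) ℂ ⧸ idealX.toIdeal) ⧸ Ideal.span {coord i - 1}) ≃ₐ[ℂ] ChartRing i :=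
  (Ideal.quotientEquivAlgOfEq ℂ (by
    rw [Ideal.map_span, Set.image_singleton, map_sub, map_one]; rfl)).trans
    ((DoubleQuot.quotQuotEquivQuotSupₐ ℂ idealX.toIdeal (Ideal.span {X i - 1})).trans
      (Ideal.quotientEquivAlgOfEq ℂ (span_chartEqs i)))

theorem quotCoordEquiv_mk (i : Fin 8) (p : MvPolynomial (Fin 8) ℂ) :
    quotCoordEquiv i (Ideal.Quotient.mk _ (Ideal.Quotient.mk _ p)) = Ideal.Quotient.mk _ p :=
  rfl

/-- The coordinate ring of the chart `x_i ≠ 0`. -/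
def chartEquiv (i : Fin 8) :
    HomogeneousLocalization.Away (quotGrading idealX) (coord i) ≃+* ChartRing i :=
  (awayEquivQuotient (quotGrading idealX) (coord_mem i)).trans (quotCoordEquiv i).toRingEquiv

theorem chartEquiv_mk (i : Fin 8) (n : ℕ) (p : MvPolynomial (Fin 8) ℂ)
    (hp : Ideal.Quotient.mk _ p ∈ quotGrading idealX (n • 1)) :
    chartEquiv i (HomogeneousLocalization.Away.mk (quotGrading idealX) (coord_mem i) n _ hp)
      = Ideal.Quotient.mk _ p := by
  change quotCoordEquiv i (awayToQuotient _ _ _) = _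
  rw [awayToQuotient_mk, quotCoordEquiv_mk]

/-- The inclusion of the open subscheme `D₊(x_i)`. -/
def coordι (i : Fin 8) :
    Spec (CommRingCat.of (HomogeneousLocalization.Away (quotGrading idealX) (coord i))) ⟶
      fourfold :=
  Proj.awayι (quotGrading idealX) (coord i) (coord_mem i) one_pos

instance isOpenImmersion_coordι (i : Fin 8) : IsOpenImmersion (coordι i) :=
  inferInstanceAs (IsOpenImmersion
    (Proj.awayι (quotGrading idealX) (coord i) (coord_mem i) one_pos))

theorem coordι_comp_fourfoldStr (i : Fin 8) :
    coordι i ≫ fourfoldStr = Spec.map (CommRingCat.ofHom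
      ((HomogeneousLocalization.fromZeroRingHom (quotGrading idealX)
        (Submonoid.powers (coord i))).comp (algebraMap ℂ (quotGrading idealX 0)))) := by
  rw [CommRingCat.ofHom_comp, Spec.map_comp]
  exact Proj.awayι_toSpecZero_assoc _ _ _ _ _

/-- The inclusion of the chart `x_i = 1`. -/
def chartι (i : Fin 8) : Spec (CommRingCat.of (ChartRing i)) ⟶ fourfold :=
  Spec.map (CommRingCat.ofHom (chartEquiv i).toRingHom) ≫ coordι i

instance isIso_specMap_chartEquiv (i : Fin 8) :
    IsIso (Spec.map (CommRingCat.ofHom (chartEquiv i).toRingHom)) :=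
  inferInstanceAs (IsIso (Spec.map (chartEquiv i).toCommRingCatIso.hom))

instance isOpenImmersion_chartι (i : Fin 8) : IsOpenImmersion (chartι i) :=
  IsOpenImmersion.comp _ _

theorem chartι_comp_fourfoldStr (i : Fin 8) :
    chartι i ≫ fourfoldStr = Spec.map (CommRingCat.ofHom (algebraMap ℂ (ChartRing i))) := by
  have h := awayToQuotient_comp_fromZeroRingHom (quotGrading idealX) (coord i)
  have h' : (chartEquiv i).toRingHom.comp ((HomogeneousLocalization.fromZeroRingHom
      (quotGrading idealX) (Submonoid.powers (coord i))).comp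
        (algebraMap ℂ (quotGrading idealX 0))) = algebraMap ℂ (ChartRing i) := by
    rw [← (quotCoordEquiv i).toAlgHom.comp_algebraMap, ← h]
    rfl
  rw [chartι, Category.assoc, coordι_comp_fourfoldStr, ← Spec.map_comp, ← CommRingCat.ofHom_comp,
    h']

/-- This is what makes the eight charts a cover. -/
theorem irrelevant_le_span_coord :
    (HomogeneousIdeal.irrelevant (quotGrading idealX)).toIdeal
      ≤ Ideal.span (Set.range coord) := by
  rw [HomogeneousIdeal.toIdeal_irrelevant_le]
  rintro n hn _ ⟨p, hp, rfl⟩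
  have hp' : p ∈ Ideal.span (Set.range (X : Fin 8 → MvPolynomial (Fin 8) ℂ)) := by
    have : (Set.range (X : Fin 8 → MvPolynomial (Fin 8) ℂ)) = X '' Set.univ := by simp
    rw [this, mem_ideal_span_X_image]
    intro m hm
    have hdeg : m.degree = n := by
      have h := (mem_homogeneousSubmodule n p).mp hp
      rw [← h (mem_support_iff.mp hm), Finsupp.degree_eq_weight_one]
      rfl
    by_contra! hc
    have : m = 0 := by
      ext j
      exact hc j trivial
    rw [this] at hdeg
    simp at hdeg
    omega
  have := Ideal.mem_map_of_mem (Ideal.Quotient.mk idealX.toIdeal) hp'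
  rwa [Ideal.map_span, ← Set.range_comp] at this

/-- Contracting a linear relation between the gradients with x kills the quadric terms by Euler's
relation and leaves the coefficient of x_i - 1, which is thus zero. The rest is excluded by
`point_eq_zero`, as x_i = 1. -/
theorem eval_pderiv_chartEqs_linearIndependent (i : Fin 8) (x : Fin 8 → ℂ)
    (hx : ∀ k, eval x (chartEqs i k) = 0) :
    LinearIndependent ℂ fun k j => eval x (pderiv j (chartEqs i k)) := by
  have hxi : x i = 1 := by
    have := hx 0
    simpa [chartEqs, sub_eq_zero] using this
  have hQ (k : Fin 3) : quadVal x k = 0 := by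
    have := hx k.succ
    rwa [chartEqs, Fin.cons_succ, eval_quadric] at this
  have hgrad (k : Fin 3) (j : Fin 8) : eval x (pderiv j (quadric k)) = quadGrad x k j := by
    rw [pderiv_quadric, map_quadGrad]
    simp
  rw [Fintype.linearIndependent_iff]
  intro g hg
  have hg' (j : Fin 8) : g 0 * (if i = j then 1 else 0) + ∑ k : Fin 3, g k.succ * quadGrad x k j
      = 0 := by
    have := congrFun hg j
    rw [Fin.sum_univ_succ] at this
    simpa [chartEqs, hgrad, pderiv_X, Pi.single_apply, eq_comm] using this
  have hsum : ∑ j, (g 0 * (if i = j then 1 else 0)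
      + ∑ k : Fin 3, g k.succ * quadGrad x k j) * x j = g 0 := by
    have : ∀ j, (g 0 * (if i = j then 1 else 0)
      + ∑ k : Fin 3, g k.succ * quadGrad x k j) * x j = g 0 * (if i = j then x j else 0)
        + ∑ k : Fin 3, g k.succ * (quadGrad x k j * x j) := fun j => by
      rw [add_mul, Finset.sum_mul]
      congr 1
      · split_ifs <;> ring
      · exact Finset.sum_congr rfl fun k _ => by ring
    rw [Finset.sum_congr rfl fun j _ => this j, Finset.sum_add_distrib, Finset.sum_comm]
    simp [← Finset.mul_sum, sum_quadGrad_mul, hQ, hxi]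
  have h0 : g 0 = 0 := by
    rw [← hsum]
    exact Finset.sum_eq_zero fun j _ => by rw [hg', zero_mul]
  by_contra! hne
  have hl : (fun k : Fin 3 => g k.succ) ≠ 0 := by
    intro h
    obtain ⟨k, hk⟩ := hne
    induction k using Fin.cases with
    | zero => exact hk h0
    | succ k => exact hk (congrFun h k)
  have := point_eq_zero hl hQ fun j => by simpa [h0] using hg' j
  rw [this] at hxi
  simp at hxi

theorem smoothOfRelativeDimension_fourfoldStr : SmoothOfRelativeDimension 4 fourfoldStr := by
  let 𝒰 := (Proj.affineOpenCoverOfIrrelevantLESpan (quotGrading idealX) coord coord_mem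
    (fun _ => one_pos) irrelevant_le_span_coord).openCover
  have hP : HasRingHomProperty (@SmoothOfRelativeDimension.{0} 4)
      (RingHom.Locally (RingHom.IsStandardSmoothOfRelativeDimension 4)) := inferInstance
  have : IsZariskiLocalAtSource (@SmoothOfRelativeDimension.{0} 4) := hP.instIsZariskiLocalAtSource
  have : MorphismProperty.RespectsIso (@SmoothOfRelativeDimension.{0} 4) :=
    this.toRespects
  have key (i : Fin 8) : SmoothOfRelativeDimension 4 (coordι i ≫ fourfoldStr) := by
    rw [← MorphismProperty.cancel_left_of_respectsIso (@SmoothOfRelativeDimension.{0} 4)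
      (Spec.map (CommRingCat.ofHom (chartEquiv i).toRingHom)), ← Category.assoc]
    change SmoothOfRelativeDimension 4 (chartι i ≫ fourfoldStr)
    rw [chartι_comp_fourfoldStr, HasRingHomProperty.Spec_iff (P := @SmoothOfRelativeDimension.{0} 4)]
    exact locally_isStandardSmooth_quotient (chartEqs i)
      (eval_pderiv_chartEqs_linearIndependent i)
  exact IsZariskiLocalAtSource.of_openCover (P := @SmoothOfRelativeDimension.{0} 4) 𝒰 key

/-! ### The line -/

section Factor

variable {σ : Type} {I J : HomogeneousIdeal (homogeneousSubmodule σ ℂ)}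

/-- The map of graded rings `ℂ[x_σ] / I ⟶ ℂ[x_σ] / J` for `I ≤ J`. -/
def factorGraded (h : I.toIdeal ≤ J.toIdeal) : quotGrading I →+*ᵍ quotGrading J where
  toRingHom := Ideal.Quotient.factor h
  map_mem := by
    rintro n _ ⟨p, hp, rfl⟩
    exact mk_mem_quotGrading J hp

theorem irrelevant_le_map_factorGraded (h : I.toIdeal ≤ J.toIdeal) :
    HomogeneousIdeal.irrelevant (quotGrading J)
      ≤ (HomogeneousIdeal.irrelevant (quotGrading I)).map (factorGraded h) := by
  rw [HomogeneousIdeal.irrelevant_le]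
  rintro n hn _ ⟨p, hp, rfl⟩
  exact Ideal.mem_map_of_mem (factorGraded h)
    (HomogeneousIdeal.mem_irrelevant_of_mem (quotGrading I) hn (mk_mem_quotGrading I hp))

theorem exists_comp_projEmb_eq (h : I.toIdeal ≤ J.toIdeal) :
    ∃ j : projScheme J ⟶ projScheme I, j ≫ projEmb I = projEmb J :=
  ⟨Proj.map (factorGraded h) (irrelevant_le_map_factorGraded h),
    (Proj.map_comp (mkGraded I) (factorGraded h) (irrelevant_le_map_mkGraded I)
      (irrelevant_le_map_factorGraded h)).symm⟩

end Factor

/-- Every monomial of the three forms contains one of x_2, …, x_7. -/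
theorem idealX_le_idealLine : idealX.toIdeal ≤ idealLine.toIdeal := by
  have hX (j : Fin 6) : (X (Fin.natAdd 2 j) : MvPolynomial (Fin 8) ℂ) ∈ idealLine.toIdeal :=
    Ideal.subset_span ⟨j, rfl⟩
  have h2 : (X 2 : MvPolynomial (Fin 8) ℂ) ∈ idealLine.toIdeal := hX 0
  have h3 : (X 3 : MvPolynomial (Fin 8) ℂ) ∈ idealLine.toIdeal := hX 1
  have h4 : (X 4 : MvPolynomial (Fin 8) ℂ) ∈ idealLine.toIdeal := hX 2
  have h5 : (X 5 : MvPolynomial (Fin 8) ℂ) ∈ idealLine.toIdeal := hX 3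
  have h6 : (X 6 : MvPolynomial (Fin 8) ℂ) ∈ idealLine.toIdeal := hX 4
  have h7 : (X 7 : MvPolynomial (Fin 8) ℂ) ∈ idealLine.toIdeal := hX 5
  rw [← Ideal.Quotient.eq_zero_iff_mem] at h2 h3 h4 h5 h6 h7
  refine Ideal.span_le.mpr ?_
  rintro _ ⟨i, rfl⟩
  change quadric i ∈ idealLine.toIdeal
  rw [← Ideal.Quotient.eq_zero_iff_mem]
  fin_cases i <;>
    simp [quadric, quadric₀, quadric₁, quadric₂, h2, h3, h4, h5, h6, h7]

/-! ### The parametrization by the quadric bundle -/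

section Parametrization

variable {R S : Type*} [CommRing R] [CommRing S]

/-- The point with the coordinates `x_0`, `x_1` replaced by zero. -/
def projTail (x : Fin 8 → R) : Fin 8 → R := ![0, 0, x 2, x 3, x 4, x 5, x 6, x 7]

/-- The vector product of the coefficient vectors of `x_0` and of `x_1` in the three forms. -/
def crossVec (x : Fin 8 → R) : Fin 3 → R :=
  ![quadGrad x 1 0 * quadGrad x 2 1 - quadGrad x 2 0 * quadGrad x 1 1,
    quadGrad x 2 0 * quadGrad x 0 1 - quadGrad x 0 0 * quadGrad x 2 1,
    quadGrad x 0 0 * quadGrad x 1 1 - quadGrad x 1 0 * quadGrad x 0 1]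

/-- The polar form of the net at `l`, between `(0, 0, l, 0, 0, 0)` and `x`. -/
def sectionPolar (l : Fin 3 → R) (x : Fin 8 → R) : R :=
  ∑ i, l i * (quadGrad x i 2 * l 0 + quadGrad x i 3 * l 1 + quadGrad x i 4 * l 2)

/-- The form whose nonvanishing locus is identified with an open subset of affine space. -/
def openForm (x : Fin 8 → R) : R :=
  x 7 * crossVec x 1 * sectionPolar (crossVec x) (projTail x)

/-- The parameter of the net given by `t`. -/
def netParam (t : Fin 4 → R) : Fin 3 → R := ![t 0, 1, t 1]

/-- The point with `x_0 = x_1 = 0` and `x_3 = s` on the hyperplanes determined by `t`. -/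
def liftPoint (t : Fin 4 → R) (s : R) : Fin 8 → R :=
  ![0, 0,
    t 0 * s + ((t 0 + 3 + 11 * t 1) * t 2 + (2 * t 0 + 7 + 13 * t 1) * t 3
      + (3 * t 0 + 11 + 8 * t 1)),
    s,
    t 1 * s - ((-t 0 + 9 + 6 * t 1) * t 2 + (5 * t 0 + 4 + 7 * t 1) * t 3
      + (2 * t 0 + 1 + 3 * t 1)),
    t 2, t 3, 1]

/-- The linear coefficient of the net along `liftPoint`. -/
def paramLin (t : Fin 4 → R) : R := sectionPolar (netParam t) (liftPoint t 0)

/-- The constant coefficient of the net along `liftPoint`. -/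
def paramConst (t : Fin 4 → R) : R := ∑ i, netParam t i * quadVal (liftPoint t 0) i

/-- The minor `crossVec` at the parametrized point, cleared of denominators. -/
def paramMinor (t : Fin 4 → R) : R :=
  paramLin t ^ 2 * ((11 * t 2 + 13 * t 3 + 8) * (-t 2 + 5 * t 3 + 2))
    - (paramLin t * (t 2 + 2 * t 3 + 3) - paramConst t)
      * (paramConst t + paramLin t * (6 * t 2 + 7 * t 3 + 3))

/-- The equation of the complement of the parameter space. -/
def paramForm (t : Fin 4 → R) : R := paramLin t * paramMinor t

/-- The solution `(x_0, x_1)` of two of the three equations, given the other coordinates and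
the inverse `m` of the minor. -/
def solvePoint (y : Fin 8 → R) (m : R) : Fin 8 → R :=
  ![(quadVal y 0 * quadGrad y 2 1 - quadVal y 2 * quadGrad y 0 1) * m,
    (quadVal y 2 * quadGrad y 0 0 - quadVal y 0 * quadGrad y 2 0) * m,
    y 2, y 3, y 4, y 5, y 6, y 7]

theorem map_projTail (f : R →+* S) (x : Fin 8 → R) :
    (fun j => f (projTail x j)) = projTail fun j => f (x j) := by
  ext j
  fin_cases j <;> simp [projTail]

theorem map_crossVec (f : R →+* S) (x : Fin 8 → R) (i : Fin 3) :
    f (crossVec x i) = crossVec (fun j => f (x j)) i := by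
  fin_cases i <;> simp [crossVec, map_quadGrad]

theorem map_sectionPolar (f : R →+* S) (l : Fin 3 → R) (x : Fin 8 → R) :
    f (sectionPolar l x) = sectionPolar (fun i => f (l i)) fun j => f (x j) := by
  simp [sectionPolar, map_quadGrad]

theorem map_openForm (f : R →+* S) (x : Fin 8 → R) :
    f (openForm x) = openForm fun j => f (x j) := by
  simp only [openForm, map_mul, map_crossVec, map_sectionPolar, map_projTail]

theorem map_liftPoint_zero (f : R →+* S) (t : Fin 4 → R) :
    (fun j => f (liftPoint t 0 j)) = liftPoint (fun i => f (t i)) 0 := by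
  ext j
  fin_cases j <;> simp [liftPoint, map_ofNat]

theorem map_netParam (f : R →+* S) (t : Fin 4 → R) :
    (fun i => f (netParam t i)) = netParam fun i => f (t i) := by
  ext i
  fin_cases i <;> simp [netParam]

theorem map_paramLin (f : R →+* S) (t : Fin 4 → R) :
    f (paramLin t) = paramLin fun i => f (t i) := by
  simp only [paramLin, map_sectionPolar, map_liftPoint_zero, map_netParam]

theorem map_paramConst (f : R →+* S) (t : Fin 4 → R) :
    f (paramConst t) = paramConst fun i => f (t i) := by
  simp only [paramConst, map_sum, map_mul, map_quadVal, map_liftPoint_zero, ← map_netParam]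

theorem map_paramMinor (f : R →+* S) (t : Fin 4 → R) :
    f (paramMinor t) = paramMinor fun i => f (t i) := by
  simp [paramMinor, map_paramLin, map_paramConst, map_ofNat]

theorem map_paramForm (f : R →+* S) (t : Fin 4 → R) :
    f (paramForm t) = paramForm fun i => f (t i) := by
  simp [paramForm, map_paramLin, map_paramMinor]

theorem map_liftPoint (f : R →+* S) (t : Fin 4 → R) (s : R) :
    (fun j => f (liftPoint t s j)) = liftPoint (fun i => f (t i)) (f s) := by
  ext j
  fin_cases j <;> simp [liftPoint, map_ofNat]

theorem map_solvePoint (f : R →+* S) (y : Fin 8 → R) (m : R) :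
    (fun j => f (solvePoint y m j)) = solvePoint (fun j => f (y j)) (f m) := by
  ext j
  fin_cases j <;> simp [solvePoint, map_quadVal, map_quadGrad]

/-- The net is affine linear along `liftPoint`. -/
theorem sum_netParam_mul_quadVal_liftPoint (t : Fin 4 → R) (s : R) :
    ∑ i, netParam t i * quadVal (liftPoint t s) i = s * paramLin t + paramConst t := by
  simp [paramLin, paramConst, sectionPolar, netParam, liftPoint, quadVal, quadGrad,
    Fin.sum_univ_three]
  ring

theorem sectionPolar_liftPoint (t : Fin 4 → R) (s : R) :
    sectionPolar (netParam t) (liftPoint t s) = paramLin t := by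
  simp [paramLin, sectionPolar, netParam, liftPoint, quadGrad, Fin.sum_univ_three]
  ring

/-- Both vectors are orthogonal to the coefficient vectors of x_0 and x_1; the middle entry 1 of
`netParam` fixes the factor. -/
theorem crossVec_liftPoint (t : Fin 4 → R) (s : R) (i : Fin 3) :
    crossVec (liftPoint t s) i = crossVec (liftPoint t s) 1 * netParam t i := by
  fin_cases i <;> simp [crossVec, netParam, liftPoint, quadGrad] <;> ring

/-- The minor is quadratic in s, so multiplying by the square of `paramLin` clears the denominator
of s = -`paramConst` / `paramLin`. -/
theorem sq_mul_crossVec_liftPoint (t : Fin 4 → R) (s : R)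
    (hs : s * paramLin t = -paramConst t) :
    paramLin t ^ 2 * crossVec (liftPoint t s) 1 = paramMinor t := by
  rw [paramMinor, ← neg_neg (paramConst t), ← hs]
  simp [crossVec, liftPoint, quadGrad]
  ring

theorem quadVal_eq_add (x : Fin 8 → R) (i : Fin 3) :
    quadVal x i = x 0 * quadGrad x i 0 + x 1 * quadGrad x i 1 + quadVal (projTail x) i := by
  fin_cases i <;> simp [quadVal, quadGrad, projTail] <;> ring

theorem quadGrad_zero_projTail (x : Fin 8 → R) (i : Fin 3) :
    quadGrad (projTail x) i 0 = quadGrad x i 0 := by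
  fin_cases i <;> simp [quadGrad, projTail]

theorem quadGrad_one_projTail (x : Fin 8 → R) (i : Fin 3) :
    quadGrad (projTail x) i 1 = quadGrad x i 1 := by
  fin_cases i <;> simp [quadGrad, projTail]

theorem crossVec_projTail (x : Fin 8 → R) : crossVec (projTail x) = crossVec x := by
  simp only [crossVec, quadGrad_zero_projTail, quadGrad_one_projTail]

theorem projTail_liftPoint (t : Fin 4 → R) (s : R) :
    projTail (liftPoint t s) = liftPoint t s := by
  ext j
  fin_cases j <;> rfl

theorem projTail_solvePoint (y : Fin 8 → R) (m : R) :
    projTail (solvePoint y m) = projTail y := by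
  ext j
  fin_cases j <;> rfl

theorem sectionPolar_smul (c : R) (l : Fin 3 → R) (x : Fin 8 → R) :
    sectionPolar (fun i => c * l i) x = c ^ 2 * sectionPolar l x := by
  simp only [sectionPolar, Fin.sum_univ_three]
  ring

theorem netParam_orthogonal_zero (t : Fin 4 → R) (s : R) :
    ∑ i, netParam t i * quadGrad (liftPoint t s) i 0 = 0 := by
  simp [netParam, liftPoint, quadGrad, Fin.sum_univ_three]
  ring

theorem netParam_orthogonal_one (t : Fin 4 → R) (s : R) :
    ∑ i, netParam t i * quadGrad (liftPoint t s) i 1 = 0 := by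
  simp [netParam, liftPoint, quadGrad, Fin.sum_univ_three]
  ring

/-- The point with parameters `t`; here `b` and `m` are the inverses of `paramLin t` and
of the minor. -/
def paramPoint (t : Fin 4 → R) (b m : R) : Fin 8 → R :=
  solvePoint (liftPoint t (-paramConst t * b)) m

theorem crossVec_paramPoint (t : Fin 4 → R) (b m : R) (i : Fin 3) :
    crossVec (paramPoint t b m) i
      = crossVec (liftPoint t (-paramConst t * b)) 1 * netParam t i := by
  rw [← crossVec_projTail, paramPoint, projTail_solvePoint, projTail_liftPoint,
    crossVec_liftPoint]

theorem openForm_paramPoint (t : Fin 4 → R) (b m : R) :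
    openForm (paramPoint t b m)
      = crossVec (liftPoint t (-paramConst t * b)) 1 ^ 3 * paramLin t := by
  have h : crossVec (paramPoint t b m)
      = fun i => crossVec (liftPoint t (-paramConst t * b)) 1 * netParam t i :=
    funext fun i => crossVec_paramPoint t b m i
  have h7 : paramPoint t b m 7 = 1 := rfl
  rw [openForm, h, sectionPolar_smul, paramPoint, projTail_solvePoint, projTail_liftPoint,
    sectionPolar_liftPoint, ← paramPoint, h7]
  simp [netParam]
  ring

/-- Cramer's rule solves Q_0 = Q_2 = 0 for x_0, x_1. The choice of s makes the member λ vanish on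
the whole plane, and Q_1 = 0 follows because it has coefficient 1 in that member. -/
theorem quadVal_paramPoint (t : Fin 4 → R) (b m : R) (hb : paramLin t * b = 1)
    (hm : crossVec (liftPoint t (-paramConst t * b)) 1 * m = 1) (i : Fin 3) :
    quadVal (paramPoint t b m) i = 0 := by
  set y := liftPoint t (-paramConst t * b) with hy
  have hval (i : Fin 3) : quadVal (paramPoint t b m) i
      = paramPoint t b m 0 * quadGrad y i 0 + paramPoint t b m 1 * quadGrad y i 1
        + quadVal y i := by
    rw [quadVal_eq_add, ← quadGrad_zero_projTail, ← quadGrad_one_projTail, paramPoint,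
      projTail_solvePoint, projTail_liftPoint]
  have hx0 : paramPoint t b m 0
      = (quadVal y 0 * quadGrad y 2 1 - quadVal y 2 * quadGrad y 0 1) * m := rfl
  have hx1 : paramPoint t b m 1
      = (quadVal y 2 * quadGrad y 0 0 - quadVal y 0 * quadGrad y 2 0) * m := rfl
  have hc : crossVec y 1 = quadGrad y 2 0 * quadGrad y 0 1 - quadGrad y 0 0 * quadGrad y 2 1 :=
    rfl
  rw [hc] at hm
  have h0 : quadVal (paramPoint t b m) 0 = 0 := by
    rw [hval, hx0, hx1]
    linear_combination -quadVal y 0 * hm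
  have h2 : quadVal (paramPoint t b m) 2 = 0 := by
    rw [hval, hx0, hx1]
    linear_combination -quadVal y 2 * hm
  have hsum : ∑ i, netParam t i * quadVal (paramPoint t b m) i = 0 := by
    have e0 := netParam_orthogonal_zero t (-paramConst t * b)
    have e1 := netParam_orthogonal_one t (-paramConst t * b)
    have e2 := sum_netParam_mul_quadVal_liftPoint t (-paramConst t * b)
    rw [← hy, Fin.sum_univ_three] at e0 e1 e2
    rw [Fin.sum_univ_three, hval, hval, hval]
    linear_combination paramPoint t b m 0 * e0 + paramPoint t b m 1 * e1 + e2
      - paramConst t * hb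
  match i with
  | 0 => exact h0
  | 2 => exact h2
  | 1 =>
    rw [Fin.sum_univ_three, h0, h2] at hsum
    simpa [netParam] using hsum

/-- The parameters of a point; here `m` is the inverse of the minor. -/
def pointParam (x : Fin 8 → R) (m : R) : Fin 4 → R :=
  ![crossVec x 0 * m, crossVec x 2 * m, x 5, x 6]

theorem pointParam_paramPoint (t : Fin 4 → R) (b m : R)
    (hm : crossVec (liftPoint t (-paramConst t * b)) 1 * m = 1) :
    pointParam (paramPoint t b m) m = t := by
  ext i
  fin_cases i
  · change crossVec (paramPoint t b m) 0 * m = t 0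
    rw [crossVec_paramPoint]
    change _ * t 0 * m = t 0
    linear_combination t 0 * hm
  · change crossVec (paramPoint t b m) 2 * m = t 1
    rw [crossVec_paramPoint]
    change _ * t 1 * m = t 1
    linear_combination t 1 * hm
  · rfl
  · rfl

/-! ### Recovering a point of X from its parameters. -/

section Point

variable {x : Fin 8 → R} {m : R}

/-- Orthogonality of the cross product to its two factors is exactly the pair of equations defining
x_2 and x_4 in `liftPoint`. -/
theorem liftPoint_pointParam (h7 : x 7 = 1) (hm : crossVec x 1 * m = 1) :
    liftPoint (pointParam x m) (x 3) = projTail x := by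
  have hm' : (quadGrad x 2 0 * quadGrad x 0 1 - quadGrad x 0 0 * quadGrad x 2 1) * m = 1 := hm
  ext j
  fin_cases j <;> simp [liftPoint, pointParam, projTail, crossVec, quadGrad, h7] at hm' ⊢
  · linear_combination -(-x 2 + 3 * x 5 + 7 * x 6 + 11) * hm'
  · linear_combination (x 4 + 9 * x 5 + 4 * x 6 + 1) * hm'

theorem crossVec_mul_eq_netParam (hm : crossVec x 1 * m = 1) (i : Fin 3) :
    netParam (pointParam x m) i = m * crossVec x i := by
  fin_cases i
  · simp [netParam, pointParam, mul_comm]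
  · simp [netParam, ← hm, mul_comm]
  · simp [netParam, pointParam, mul_comm]

theorem paramLin_pointParam (h7 : x 7 = 1) (hm : crossVec x 1 * m = 1) :
    paramLin (pointParam x m) = m ^ 2 * sectionPolar (crossVec x) (projTail x) := by
  rw [← sectionPolar_liftPoint _ (x 3), liftPoint_pointParam h7 hm, ← sectionPolar_smul]
  congr 1
  exact funext (crossVec_mul_eq_netParam hm)

/-- In the combination of the Q_i by the cross product, the x_0 and x_1 terms drop out; what remains
is the affine linear equation for x_3. -/
theorem mul_paramLin_pointParam (h7 : x 7 = 1) (hm : crossVec x 1 * m = 1)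
    (hQ : ∀ i, quadVal x i = 0) :
    x 3 * paramLin (pointParam x m) = -paramConst (pointParam x m) := by
  have h := sum_netParam_mul_quadVal_liftPoint (pointParam x m) (x 3)
  have h0 := hQ 0
  have h1 := hQ 1
  have h2 := hQ 2
  rw [quadVal_eq_add] at h0 h1 h2
  simp only [liftPoint_pointParam h7 hm, Fin.sum_univ_three, crossVec_mul_eq_netParam hm] at h
  have e0 : crossVec x 0 = quadGrad x 1 0 * quadGrad x 2 1 - quadGrad x 2 0 * quadGrad x 1 1 := rfl
  have e1 : crossVec x 1 = quadGrad x 2 0 * quadGrad x 0 1 - quadGrad x 0 0 * quadGrad x 2 1 := rfl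
  have e2 : crossVec x 2 = quadGrad x 0 0 * quadGrad x 1 1 - quadGrad x 1 0 * quadGrad x 0 1 := rfl
  rw [e0, e1, e2] at h
  linear_combination -h + m * (quadGrad x 1 0 * quadGrad x 2 1 - quadGrad x 2 0 * quadGrad x 1 1)
      * h0 + m * (quadGrad x 2 0 * quadGrad x 0 1 - quadGrad x 0 0 * quadGrad x 2 1) * h1
    + m * (quadGrad x 0 0 * quadGrad x 1 1 - quadGrad x 1 0 * quadGrad x 0 1) * h2

theorem paramMinor_pointParam (h7 : x 7 = 1) (hm : crossVec x 1 * m = 1)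
    (hQ : ∀ i, quadVal x i = 0) :
    paramMinor (pointParam x m) = paramLin (pointParam x m) ^ 2 * crossVec x 1 := by
  rw [← sq_mul_crossVec_liftPoint _ _ (mul_paramLin_pointParam h7 hm hQ),
    liftPoint_pointParam h7 hm, crossVec_projTail]

theorem liftPoint_pointParam_eq (h7 : x 7 = 1) (hm : crossVec x 1 * m = 1)
    (hQ : ∀ i, quadVal x i = 0) {b : R} (hb : paramLin (pointParam x m) * b = 1) :
    liftPoint (pointParam x m) (-paramConst (pointParam x m) * b) = projTail x := by
  rw [← liftPoint_pointParam h7 hm, ← mul_paramLin_pointParam h7 hm hQ, mul_assoc, hb, mul_one]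

theorem paramPoint_pointParam (h7 : x 7 = 1) (hm : crossVec x 1 * m = 1)
    (hQ : ∀ i, quadVal x i = 0) {b : R} (hb : paramLin (pointParam x m) * b = 1) :
    paramPoint (pointParam x m) b m = x := by
  have hm' : (quadGrad x 2 0 * quadGrad x 0 1 - quadGrad x 0 0 * quadGrad x 2 1) * m = 1 := hm
  have h0 := hQ 0
  have h2 := hQ 2
  rw [quadVal_eq_add] at h0 h2
  rw [paramPoint, liftPoint_pointParam_eq h7 hm hQ hb]
  ext j
  fin_cases j
  · change (quadVal (projTail x) 0 * quadGrad (projTail x) 2 1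
      - quadVal (projTail x) 2 * quadGrad (projTail x) 0 1) * m = x 0
    rw [quadGrad_one_projTail, quadGrad_one_projTail]
    linear_combination x 0 * hm' + m * quadGrad x 2 1 * h0 - m * quadGrad x 0 1 * h2
  · change (quadVal (projTail x) 2 * quadGrad (projTail x) 0 0
      - quadVal (projTail x) 0 * quadGrad (projTail x) 2 0) * m = x 1
    rw [quadGrad_zero_projTail, quadGrad_zero_projTail]
    linear_combination x 1 * hm' + m * quadGrad x 0 0 * h2 - m * quadGrad x 2 0 * h0
  all_goals rfl

end Point

end Parametrization

/-! ### The isomorphism of coordinate rings -/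

section CoordinateRings

theorem map_paramPoint {R S : Type*} [CommRing R] [CommRing S] (f : R →+* S) (t : Fin 4 → R)
    (b m : R) (j : Fin 8) :
    f (paramPoint t b m j) = paramPoint (fun i => f (t i)) (f b) (f m) j := by
  have h := congrFun (map_solvePoint f (liftPoint t (-paramConst t * b)) m) j
  rw [map_liftPoint, map_mul, map_neg, map_paramConst] at h
  exact h

theorem map_pointParam {R S : Type*} [CommRing R] [CommRing S] (f : R →+* S) (x : Fin 8 → R)
    (m : R) (i : Fin 4) :
    f (pointParam x m i) = pointParam (fun j => f (x j)) (f m) i := by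
  fin_cases i <;> simp [pointParam, map_crossVec]

/-- The coordinate ring of an affine open subset of the fourfold. -/
abbrev OpenRing : Type :=
  Localization.Away (Ideal.Quotient.mk (Ideal.span (Set.range (chartEqs 7)))
    (openForm fun j => (X j : MvPolynomial (Fin 8) ℂ)))

/-- The coordinate ring of an affine open subset of affine space. -/
abbrev ParamRing : Type :=
  Localization.Away (paramForm fun i => (X i : MvPolynomial (Fin 4) ℂ))

/-- The tautological point of `OpenRing`. -/
def genericPoint (j : Fin 8) : OpenRing :=
  algebraMap (ChartRing 7) OpenRing (Ideal.Quotient.mk _ (X j))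

/-- The tautological parameter of `ParamRing`. -/
def genericParam (i : Fin 4) : ParamRing := algebraMap (MvPolynomial (Fin 4) ℂ) ParamRing (X i)

theorem quadVal_genericPoint (i : Fin 3) : quadVal genericPoint i = 0 := by
  have h : quadric i ∈ Ideal.span (Set.range (chartEqs 7)) := Ideal.subset_span ⟨i.succ, rfl⟩
  have h' : quadric i = quadVal (fun j => X j) i := by
    rw [← aeval_quadric, aeval_X_left_apply]
  rw [h', ← Ideal.Quotient.eq_zero_iff_mem, map_quadVal] at h
  have := congrArg (algebraMap (ChartRing 7) OpenRing) h
  rwa [map_quadVal, map_zero] at this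

theorem genericPoint_seven : genericPoint 7 = 1 := by
  have h : X 7 - 1 ∈ Ideal.span (Set.range (chartEqs 7)) := Ideal.subset_span ⟨0, rfl⟩
  rw [genericPoint, (Ideal.Quotient.mk_eq_mk_iff_sub_mem _ _).mpr h, map_one, map_one]

theorem isUnit_openForm_genericPoint : IsUnit (openForm genericPoint) := by
  have h : IsUnit (algebraMap (ChartRing 7) OpenRing (Ideal.Quotient.mk _
      (openForm fun j => (X j : MvPolynomial (Fin 8) ℂ)))) :=
    IsLocalization.Away.algebraMap_isUnit _
  have e := map_openForm ((algebraMap (ChartRing 7) OpenRing).comp (Ideal.Quotient.mk _))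
    fun j => (X j : MvPolynomial (Fin 8) ℂ)
  exact (congrArg IsUnit e).mp h

theorem isUnit_paramForm_genericParam : IsUnit (paramForm genericParam) := by
  have h : IsUnit (algebraMap (MvPolynomial (Fin 4) ℂ) ParamRing
      (paramForm fun i => (X i : MvPolynomial (Fin 4) ℂ))) :=
    IsLocalization.Away.algebraMap_isUnit _
  exact (congrArg IsUnit (map_paramForm _ _)).mp h

theorem exists_algHom_openRing {T : Type*} [CommRing T] [Algebra ℂ T] (x : Fin 8 → T)
    (hQ : ∀ i, quadVal x i = 0) (h7 : x 7 = 1) (hu : IsUnit (openForm x)) :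
    ∃ f : OpenRing →ₐ[ℂ] T, ∀ j, f (genericPoint j) = x j := by
  have hker : ∀ p ∈ Ideal.span (Set.range (chartEqs 7)), aeval (R := ℂ) x p = 0 := by
    intro p hp
    have hle : Ideal.span (Set.range (chartEqs 7)) ≤ RingHom.ker (aeval (R := ℂ) x) := by
      rw [Ideal.span_le]
      rintro _ ⟨k, rfl⟩
      induction k using Fin.cases with
      | zero => simp [chartEqs, h7]
      | succ k => simp [chartEqs, aeval_quadric, hQ]
    exact hle hp
  let φ : ChartRing 7 →ₐ[ℂ] T := Ideal.Quotient.liftₐ _ (aeval x) hker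
  have hφ (p : MvPolynomial (Fin 8) ℂ) : φ (Ideal.Quotient.mk _ p) = aeval x p := rfl
  have hφu : IsUnit (φ (Ideal.Quotient.mk _
      (openForm fun j => (X j : MvPolynomial (Fin 8) ℂ)))) := by
    have := map_openForm (aeval (R := ℂ) x).toRingHom (fun j => X j)
    rw [hφ]
    change IsUnit ((aeval (R := ℂ) x).toRingHom _)
    rw [this]
    simpa using hu
  refine ⟨IsLocalization.Away.liftAlgHom (S := OpenRing) _ hφu, fun j => ?_⟩
  rw [IsLocalization.Away.liftAlgHom_apply, genericPoint, IsLocalization.Away.lift_eq]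
  change φ _ = _
  rw [hφ, aeval_X]

theorem exists_algHom_paramRing {T : Type*} [CommRing T] [Algebra ℂ T] (t : Fin 4 → T)
    (hu : IsUnit (paramForm t)) :
    ∃ f : ParamRing →ₐ[ℂ] T, ∀ i, f (genericParam i) = t i := by
  have hφu : IsUnit (aeval (R := ℂ) t (paramForm fun i => X i)) := by
    have := map_paramForm (aeval (R := ℂ) t).toRingHom (fun i => X i)
    change IsUnit ((aeval (R := ℂ) t).toRingHom _)
    rw [this]
    simpa using hu
  refine ⟨IsLocalization.Away.liftAlgHom (S := ParamRing) _ hφu, fun i => ?_⟩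
  rw [IsLocalization.Away.liftAlgHom_apply, genericParam, IsLocalization.Away.lift_eq]
  exact aeval_X _ _

theorem openRing_algHom_ext {T : Type*} [CommRing T] [Algebra ℂ T] {f g : OpenRing →ₐ[ℂ] T}
    (h : ∀ j, f (genericPoint j) = g (genericPoint j)) : f = g := by
  refine IsLocalization.algHom_ext (Submonoid.powers (Ideal.Quotient.mk
    (Ideal.span (Set.range (chartEqs 7))) (openForm fun j => (X j : MvPolynomial (Fin 8) ℂ)))) ?_
  apply Ideal.Quotient.algHom_ext
  apply MvPolynomial.algHom_ext
  exact h

theorem paramRing_algHom_ext {T : Type*} [CommRing T] [Algebra ℂ T] {f g : ParamRing →ₐ[ℂ] T}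
    (h : ∀ i, f (genericParam i) = g (genericParam i)) : f = g := by
  refine IsLocalization.algHom_ext (Submonoid.powers
    (paramForm fun i => (X i : MvPolynomial (Fin 4) ℂ))) ?_
  apply MvPolynomial.algHom_ext
  exact h

/-- Each ring represents points satisfying equations and unit conditions, so it is enough to
exchange the tautological points by `paramPoint` and `pointParam`, which are mutually inverse. -/
theorem nonempty_openRing_algEquiv : Nonempty (OpenRing ≃ₐ[ℂ] ParamRing) := by
  have hform : IsUnit (genericPoint 7 * crossVec genericPoint 1
      * sectionPolar (crossVec genericPoint) (projTail genericPoint)) :=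
    isUnit_openForm_genericPoint
  rw [IsUnit.mul_iff, IsUnit.mul_iff] at hform
  obtain ⟨⟨-, hc⟩, hpol⟩ := hform
  obtain ⟨m', hm'⟩ := hc.exists_right_inv
  have hpform : IsUnit (paramLin genericParam * paramMinor genericParam) :=
    isUnit_paramForm_genericParam
  rw [IsUnit.mul_iff] at hpform
  obtain ⟨b, hb⟩ := hpform.1.exists_right_inv
  obtain ⟨n, hn⟩ := hpform.2.exists_right_inv
  obtain ⟨m, hm⟩ : ∃ m, crossVec (liftPoint genericParam (-paramConst genericParam * b)) 1 * m
      = 1 := by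
    -- `paramLin`² times the minor is `paramMinor`, whose inverse is n.
    refine ⟨paramLin genericParam ^ 2 * n, ?_⟩
    rw [← mul_assoc, mul_comm (crossVec _ _), sq_mul_crossVec_liftPoint _ _ (by
      linear_combination -paramConst genericParam * hb), hn]
  have hcm := IsUnit.of_mul_eq_one _ hm
  obtain ⟨f, hf⟩ := exists_algHom_openRing (paramPoint genericParam b m)
    (quadVal_paramPoint _ b m hb hm) rfl (by
      rw [openForm_paramPoint]
      exact (hcm.pow 3).mul hpform.1)
  have hlin : IsUnit (paramLin (pointParam genericPoint m')) := by
    rw [paramLin_pointParam genericPoint_seven hm']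
    exact ((IsUnit.of_mul_eq_one_right _ hm').pow 2).mul hpol
  obtain ⟨g, hg⟩ := exists_algHom_paramRing (pointParam genericPoint m') (by
    rw [paramForm, paramMinor_pointParam genericPoint_seven hm' quadVal_genericPoint]
    exact hlin.mul ((hlin.pow 2).mul hc))
  have hf' : (fun j => (f : OpenRing →+* ParamRing) (genericPoint j))
      = paramPoint genericParam b m := funext hf
  have hg' : (fun i => (g : ParamRing →+* OpenRing) (genericParam i))
      = pointParam genericPoint m' := funext hg
  refine ⟨AlgEquiv.ofAlgHom f g (paramRing_algHom_ext fun i => ?_)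
    (openRing_algHom_ext fun j => ?_)⟩
  -- Both are inverses of the same minor, hence equal.
  · have hfm : f m' = m := by
      have h := congrArg (f : OpenRing →+* ParamRing) hm'
      rw [map_mul, map_one, map_crossVec, hf', crossVec_paramPoint] at h
      have h1 : netParam genericParam 1 = 1 := rfl
      rw [h1, mul_one] at h
      exact hcm.mul_left_cancel (h.trans hm.symm)
    change f (g (genericParam i)) = genericParam i
    rw [hg]
    change (f : OpenRing →+* ParamRing) _ = _
    rw [map_pointParam, hf']
    change pointParam _ (f m') i = _
    rw [hfm, pointParam_paramPoint _ _ _ hm]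
  · have hgb := congrArg (g : ParamRing →+* OpenRing) hb
    rw [map_mul, map_one, map_paramLin, hg'] at hgb
    have hgm : g m = m' := by
      have h := congrArg (g : ParamRing →+* OpenRing) hm
      rw [map_mul, map_one, map_crossVec, map_liftPoint, map_mul, map_neg, map_paramConst, hg',
        liftPoint_pointParam_eq genericPoint_seven hm' quadVal_genericPoint hgb,
        crossVec_projTail] at h
      exact hc.mul_left_cancel (h.trans hm'.symm)
    change g (f (genericPoint j)) = genericPoint j
    rw [hf]
    change (g : ParamRing →+* OpenRing) _ = _
    rw [map_paramPoint, hg']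
    change paramPoint _ _ (g m) j = _
    rw [hgm, paramPoint_pointParam genericPoint_seven hm' quadVal_genericPoint hgb]

end CoordinateRings

/-! ### The locus where the parametrization fails -/

section LinearSection

variable {R S : Type*} [CommRing R] [CommRing S]

/-- Four linear forms. -/
def linForms (x : Fin 8 → R) : Fin 4 → R := ![x 1, x 3, x 4 + 2 * x 0, x 5 - x 2]

theorem map_linForms (f : R →+* S) (x : Fin 8 → R) (i : Fin 4) :
    f (linForms x i) = linForms (fun j => f (x j)) i := by
  fin_cases i <;> simp [linForms, map_ofNat]

theorem linForms_smul (c : R) (x : Fin 8 → R) (i : Fin 4) :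
    linForms (fun j => c * x j) i = c * linForms x i := by
  fin_cases i <;> simp [linForms] <;> ring

theorem crossVec_smul (c : R) (x : Fin 8 → R) (i : Fin 3) :
    crossVec (fun j => c * x j) i = c ^ 2 * crossVec x i := by
  fin_cases i <;> simp [crossVec, quadGrad_smul] <;> ring

theorem openForm_smul (c : R) (x : Fin 8 → R) :
    openForm (fun j => c * x j) = c ^ 8 * openForm x := by
  have h1 : crossVec (fun j => c * x j) = fun i => c ^ 2 * crossVec x i :=
    funext (crossVec_smul c x)
  have h2 : projTail (fun j => c * x j) = fun j => c * projTail x j := by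
    ext j
    fin_cases j <;> simp [projTail]
  rw [openForm, h1, sectionPolar_smul, h2]
  simp only [sectionPolar, quadGrad_smul, openForm, Fin.sum_univ_three]
  ring

theorem intCast_ne_zero_of_mod_five {k : Type*} [Field k] (h5 : (5 : k) = 0) {n : ℤ}
    (hn : n % 5 ≠ 0) : (n : k) ≠ 0 := by
  intro h
  have hg : Int.gcd n 5 = 1 := by
    have h1 : Int.gcd n 5 ∣ 5 := by exact_mod_cast Int.gcd_dvd_right n 5
    rcases (Nat.dvd_prime Nat.prime_five).mp h1 with h1 | h1
    · exact h1
    · exact absurd (Int.emod_eq_zero_of_dvd (by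
        have h2 := Int.gcd_dvd_left n 5
        rwa [h1] at h2)) hn
  have hb := Int.gcd_eq_gcd_ab n 5
  rw [hg] at hb
  have : ((1 : ℕ) : k) = 0 := by
    have := congrArg (Int.cast : ℤ → k) hb
    push_cast at this
    rw [h, h5] at this
    simp at this
  simp at this

/-- Modulo 5 the linear section of X consists of four points only, all rational, and `openForm` is
nonzero at each. -/
theorem eq_zero_of_linForms_char_five {k : Type*} [Field k] (h5 : (5 : k) = 0) (x : Fin 8 → k)
    (hQ : ∀ i, quadVal x i = 0) (hg : openForm x = 0) (hl : ∀ i, linForms x i = 0) : x = 0 := by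
  have l0 : x 1 = 0 := hl 0
  have l1 : x 3 = 0 := hl 1
  have l2 : x 4 = -2 * x 0 := by
    have h : x 4 + 2 * x 0 = 0 := hl 2
    linear_combination h
  have l3 : x 5 = x 2 := by
    have h : x 5 - x 2 = 0 := hl 3
    linear_combination h
  have q0 := hQ 0
  have q1 := hQ 1
  have q2 := hQ 2
  simp [quadVal, l0, l1, l2, l3] at q0 q1 q2
  -- On the linear section, combinations of the forms modulo 5 become a square and, once x_0 = -2x_6
  -- is substituted, two products of linear factors.
  have e0 : x 0 = -2 * x 6 := by
    have h : (x 0 + 2 * x 6) ^ 2 = 0 := by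
      linear_combination q0 + 4 * q1 + 4 * q2
        + (-3 * x 0 ^ 2 - 5 * x 6 ^ 2 - 11 * x 0 * x 2 - 11 * x 0 * x 7 - 14 * x 2 ^ 2
          - 13 * x 7 ^ 2 - 16 * x 0 * x 6 - 4 * x 2 * x 7) * h5
    linear_combination pow_eq_zero_iff (two_ne_zero) |>.mp h
  have e1 : x 7 = -x 6 ∨ x 7 = 2 * x 6 := by
    have h : (x 7 + x 6) * (x 7 - 2 * x 6) = 0 := by
      rw [e0] at q0 q1 q2
      linear_combination 4 * q0 + 8 * q1 + 12 * q2
        + (-35 * x 7 ^ 2 + 59 * x 6 * x 7 + 50 * x 6 ^ 2 + 64 * x 2 * x 6 - 40 * x 2 ^ 2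
          - 12 * x 2 * x 7) * h5
    exact (mul_eq_zero.mp h).imp (fun h => by linear_combination h)
      fun h => by linear_combination h
  have e2 : x 2 = 0 ∨ x 2 = 3 * x 6 := by
    have h : x 2 * (x 2 - 3 * x 6) = 0 := by
      rw [e0] at q1
      linear_combination 2 * q1
        + (-x 2 ^ 2 + x 2 * x 6 - 2 * x 6 ^ 2 + 4 * x 6 * x 7 - 2 * x 7 ^ 2) * h5
    exact (mul_eq_zero.mp h).imp (fun h => by linear_combination h)
      fun h => by linear_combination h
  -- Each of the four points is x_6 times an integral vector n, so `openForm` is x_6⁸ times an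
  -- integer prime to 5.
  have key (n : Fin 8 → ℤ) (hn : openForm n % 5 ≠ 0) (hx : ∀ j, x j = x 6 * n j) : x = 0 := by
    have hx' : x = fun j => x 6 * (Int.castRingHom k) (n j) := funext hx
    rw [hx', openForm_smul, ← map_openForm, mul_eq_zero, pow_eq_zero_iff (by norm_num)] at hg
    have h6 := hg.resolve_right (intCast_ne_zero_of_mod_five h5 hn)
    ext j
    rw [hx, h6, zero_mul, Pi.zero_apply]
  rcases e1 with e1 | e1 <;> rcases e2 with e2 | e2
  · refine key ![-2, 0, 0, 0, 4, 0, 1, -1] (by decide +kernel) fun j => ?_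
    fin_cases j <;> simp [l0, l1, l2, l3, e0, e1, e2] <;> ring
  · refine key ![-2, 0, 3, 0, 4, 3, 1, -1] (by decide +kernel) fun j => ?_
    fin_cases j <;> simp [l0, l1, l2, l3, e0, e1, e2] <;> ring
  · refine key ![-2, 0, 0, 0, 4, 0, 1, 2] (by decide +kernel) fun j => ?_
    fin_cases j <;> simp [l0, l1, l2, l3, e0, e1, e2] <;> ring
  · refine key ![-2, 0, 3, 0, 4, 3, 1, 2] (by decide +kernel) fun j => ?_
    fin_cases j <;> simp [l0, l1, l2, l3, e0, e1, e2] <;> ring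

/-- Specialization along a valuation ring that contains the linear forms but not all
coordinates. -/
theorem exists_residue_point {K : Type*} [Field K] (V : ValuationSubring K) {x : Fin 8 → K}
    (hQ : ∀ i, quadVal x i = 0) (hg : openForm x = 0) (hl : ∀ i, linForms x i ∈ V)
    {j : Fin 8} (hj : x j ∉ V) :
    ∃ w : Fin 8 → IsLocalRing.ResidueField V, w ≠ 0 ∧ (∀ i, quadVal w i = 0) ∧ openForm w = 0 ∧
      ∀ i, linForms w i = 0 := by
  have hx : x ≠ 0 := by
    rintro rfl
    exact hj V.zero_mem
  obtain ⟨c, w, hw, i₀, hi₀⟩ := exists_smul_mem_valuationSubring V hx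
  have hw' : (fun j => V.subtype (w j)) = fun j => c * x j := funext hw
  have hc0 : c ≠ 0 := by
    rintro rfl
    have := hw i₀
    simp [hi₀] at this
  -- The normalizing factor c lies in the maximal ideal, since some coordinate of x is not integral;
  -- this sends the integral linear forms to zero.
  have hc : c⁻¹ ∉ V := fun h => hj (by
    have : x j = c⁻¹ * (w j : K) := by rw [hw, inv_mul_cancel_left₀ hc0]
    rw [this]
    exact V.mul_mem _ _ h (w j).2)
  have hcV : c ∈ V := (V.mem_or_inv_mem c).resolve_right hc
  have hcres : IsLocalRing.residue V ⟨c, hcV⟩ = 0 := by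
    rw [IsLocalRing.residue_eq_zero_iff, IsLocalRing.mem_maximalIdeal]
    intro hu
    obtain ⟨d, hd⟩ := hu.exists_right_inv
    have : c⁻¹ = (d : K) := by
      have : c * (d : K) = 1 := congrArg Subtype.val hd
      exact (eq_inv_of_mul_eq_one_right this).symm
    exact hc (this ▸ d.2)
  have hinj : Function.Injective V.subtype := Subtype.val_injective
  refine ⟨fun j => IsLocalRing.residue V (w j), ?_, fun i => ?_, ?_, fun i => ?_⟩
  · intro h
    have := congrFun h i₀
    simp [hi₀] at this
  · rw [← map_quadVal]
    have : quadVal w i = 0 := hinj (by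
      rw [map_quadVal, hw', quadVal_smul, hQ, mul_zero, map_zero])
    rw [this, map_zero]
  · rw [← map_openForm]
    have : openForm w = 0 := hinj (by
      rw [map_openForm, hw', openForm_smul, hg, mul_zero, map_zero])
    rw [this, map_zero]
  · rw [← map_linForms]
    have : linForms w i = ⟨c, hcV⟩ * ⟨linForms x i, hl i⟩ := hinj (by
      rw [map_linForms, hw', linForms_smul]
      rfl)
    rw [this, map_mul, hcres, zero_mul]

/-- Lifts the statement from characteristic 5 to characteristic 0 by specialization along a
valuation ring. -/
theorem eq_zero_of_linForms {K : Type*} [Field K] [CharZero K] (x : Fin 8 → K)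
    (hQ : ∀ i, quadVal x i = 0) (hg : openForm x = 0) (hl : ∀ i, linForms x i = 0) : x = 0 := by
  by_contra hx
  obtain ⟨j, hj⟩ := Function.ne_iff.mp hx
  obtain ⟨V, hV⟩ := exists_valuationSubring_residueField_natCast_eq_zero K 5 Nat.prime_five
  have h5 : (5 : K)⁻¹ ∉ V := by
    intro h
    have h1 : (5 : V) * ⟨(5 : K)⁻¹, h⟩ = 1 := Subtype.ext (by
      change (5 : K) * (5 : K)⁻¹ = 1
      exact mul_inv_cancel₀ (by norm_num))
    have h2 := congrArg (IsLocalRing.residue V) h1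
    rw [map_mul, map_ofNat, map_one] at h2
    rw [Nat.cast_ofNat] at hV
    rw [hV, zero_mul] at h2
    exact zero_ne_one h2
  -- This scaling makes the j-th coordinate 1/5, which is not in V, as the specialization requires.
  let c : K := 5⁻¹ * (x j)⁻¹
  obtain ⟨w, hw0, hwQ, hwg, hwl⟩ := exists_residue_point V (x := fun i => c * x i) (j := j)
    (fun i => by rw [quadVal_smul, hQ, mul_zero]) (by rw [openForm_smul, hg, mul_zero])
    (fun i => by rw [linForms_smul, hl, mul_zero]; exact V.zero_mem)
    (by
      have : c * x j = 5⁻¹ := by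
        simp only [c]
        rw [mul_assoc, inv_mul_cancel₀ hj, mul_one]
      rwa [this])
  exact hw0 (eq_zero_of_linForms_char_five (by exact_mod_cast hV) w hwQ hwg hwl)

/-- The coordinates of a point where the parametrization fails are integral over the values of
the linear forms. -/
theorem isIntegral_of_openForm_eq_zero {k A K : Type*} [Field k] [CharZero k] [CommRing A]
    [Algebra k A] [Field K] [Algebra A K] (x : Fin 8 → K) (hQ : ∀ i, quadVal x i = 0)
    (hg : openForm x = 0) (hl : ∀ i, linForms x i ∈ (algebraMap A K).range) (j : Fin 8) :
    IsIntegral A (x j) := by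
  by_contra hj
  let B : Subring K := (integralClosure A K).toSubring
  have : IsIntegrallyClosedIn B K :=
    inferInstanceAs (IsIntegrallyClosedIn (integralClosure A K) K)
  -- A nonintegral element is avoided by some valuation ring containing the integral closure.
  obtain ⟨V, hBV, hjV⟩ := B.exists_le_valuationSubring_of_isIntegrallyClosedIn (x := x j) hj
  have hAV (a : A) : algebraMap A K a ∈ V := hBV ((integralClosure A K).algebraMap_mem a)
  obtain ⟨w, hw0, hwQ, hwg, hwl⟩ := exists_residue_point V hQ hg
    (fun i => by obtain ⟨a, ha⟩ := hl i; exact ha ▸ hAV a) hjV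
  let φ : A →+* V := (algebraMap A K).codRestrict V hAV
  -- The residue field contains the image of k, so the statement in characteristic zero applies to
  -- it.
  have : CharZero (IsLocalRing.ResidueField V) :=
    charZero_of_injective_ringHom
      (((IsLocalRing.residue V).comp φ).comp (algebraMap k A)).injective
  exact hw0 (eq_zero_of_linForms w hwQ hwg hwl)

end LinearSection

/-! ### Density of the open set -/

section Dimension

/-- The translation of affine space by `c`. -/
def translate {σ K : Type*} [CommRing K] (c : σ → K) : MvPolynomial σ K ≃ₐ[K] MvPolynomial σ K :=
  AlgEquiv.ofAlgHom (aeval fun i => X i + C (c i)) (aeval fun i => X i - C (c i))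
    (by ext i; simp) (by ext i; simp)

/-- Translations permute the maximal ideals transitively, so all have the same height, and the
supremum of the heights is the Krull dimension. -/
theorem height_eq_of_isMaximal {σ K : Type*} [Finite σ] [Field K] [IsAlgClosed K]
    (m : Ideal (MvPolynomial σ K)) (hm : m.IsMaximal) : m.height = Nat.card σ := by
  have hsame (m' : Ideal (MvPolynomial σ K)) (hm' : m'.IsMaximal) : m'.height = m.height := by
    obtain ⟨a, rfl⟩ := isMaximal_iff_eq_vanishingIdeal_singleton.mp hm
    obtain ⟨b, rfl⟩ := isMaximal_iff_eq_vanishingIdeal_singleton.mp hm'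
    have : vanishingIdeal K {b}
        = (vanishingIdeal K {a}).comap (translate (b - a) : MvPolynomial σ K ≃ₐ[K] _) := by
      ext p
      rw [Ideal.mem_comap, mem_vanishingIdeal_singleton_iff, mem_vanishingIdeal_singleton_iff]
      have h : (aeval (R := K) a).comp (translate (b - a)).toAlgHom = aeval b := by
        ext i
        simp [translate]
      rw [← h]
      rfl
    rw [this]
    exact (translate (b - a)).toRingEquiv.height_comap _
  have hsup := Ideal.sup_isMaximal_height_eq_ringKrullDim (R := MvPolynomial σ K)
  rw [MvPolynomial.ringKrullDim_of_isNoetherianRing, ringKrullDim_eq_zero_of_field, zero_add]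
    at hsup
  have : (⨆ (I : Ideal (MvPolynomial σ K)) (_ : I.IsMaximal), I.height) = m.height := by
    refine le_antisymm (iSup₂_le fun I hI => (hsame I hI).le) ?_
    exact le_iSup₂_of_le m hm le_rfl
  rw [this] at hsup
  exact_mod_cast hsup

/-- By incomparability, strict chains of primes contract to strict chains. -/
theorem ringKrullDim_le_of_isIntegral (A B : Type*) [CommRing A] [CommRing B] [Algebra A B]
    [Algebra.IsIntegral A B] : ringKrullDim B ≤ ringKrullDim A :=
  Order.krullDim_le_of_strictMono (PrimeSpectrum.comap (algebraMap A B)) fun _ _ h =>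
    Ideal.IsIntegral.comap_lt_comap h

/-- An irreducible component of the locus where the parametrization fails has dimension at most
four (as a cone). -/
theorem ringKrullDim_quotient_le_four (P : Ideal (MvPolynomial (Fin 8) ℂ)) [P.IsPrime]
    (hI : idealX.toIdeal ≤ P) (hg : openForm (fun j => (X j : MvPolynomial (Fin 8) ℂ)) ∈ P) :
    ringKrullDim (MvPolynomial (Fin 8) ℂ ⧸ P) ≤ 4 := by
  let D := MvPolynomial (Fin 8) ℂ ⧸ P
  let xD : Fin 8 → D := fun j => Ideal.Quotient.mk P (X j)
  -- The four linear forms serve as a finite projection to four-dimensional affine space.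
  let φ : MvPolynomial (Fin 4) ℂ →ₐ[ℂ] D := aeval (linForms xD)
  let _ : Algebra (MvPolynomial (Fin 4) ℂ) D := φ.toRingHom.toAlgebra
  let K := FractionRing D
  let x : Fin 8 → K := fun j => algebraMap D K (xD j)
  have hQ (i : Fin 3) : quadVal x i = 0 := by
    have h : quadric i ∈ P := hI (Ideal.subset_span ⟨i, rfl⟩)
    have h' : quadric i = quadVal (fun j => X j) i := by
      rw [← aeval_quadric, aeval_X_left_apply]
    rw [h', ← Ideal.Quotient.eq_zero_iff_mem, map_quadVal] at h
    rw [← map_quadVal, h, map_zero]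
  have hg' : openForm x = 0 := by
    rw [← Ideal.Quotient.eq_zero_iff_mem, map_openForm] at hg
    rw [← map_openForm, hg, map_zero]
  have hl (i : Fin 4) : linForms x i ∈ (algebraMap (MvPolynomial (Fin 4) ℂ) K).range := by
    refine ⟨X i, ?_⟩
    rw [IsScalarTower.algebraMap_apply (MvPolynomial (Fin 4) ℂ) D K, ← map_linForms]
    congr 1
    exact aeval_X _ _
  have hx (j : Fin 8) : IsIntegral (MvPolynomial (Fin 4) ℂ) (xD j) :=
    (isIntegral_algebraMap_iff (IsFractionRing.injective D K)).mp
      (isIntegral_of_openForm_eq_zero (k := ℂ) x hQ hg' hl j)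
  have : Algebra.IsIntegral (MvPolynomial (Fin 4) ℂ) D := ⟨fun d => by
    obtain ⟨p, rfl⟩ := Ideal.Quotient.mk_surjective d
    induction p using MvPolynomial.induction_on with
    | C a =>
      have : Ideal.Quotient.mk P (C a) = algebraMap (MvPolynomial (Fin 4) ℂ) D (C a) :=
        (φ.commutes a).symm
      rw [this]
      exact isIntegral_algebraMap
    | add p q hp hq => rw [map_add]; exact hp.add hq
    | mul_X p j hp => rw [map_mul]; exact hp.mul (hx j)⟩
  refine (ringKrullDim_le_of_isIntegral (MvPolynomial (Fin 4) ℂ) D).trans ?_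
  rw [MvPolynomial.ringKrullDim_of_isNoetherianRing, ringKrullDim_eq_zero_of_field]
  simp

/-- The form is a nonzerodivisor modulo the radical. A failure would give a prime over the ideal
containing it with quotient of dimension at least 8 - 3 = 5, against the bound 4 above. -/
theorem mem_radical_of_mul_openForm_mem {f : MvPolynomial (Fin 8) ℂ}
    (hf : f * openForm (fun j => X j) ∈ idealX.toIdeal.radical) :
    f ∈ idealX.toIdeal.radical := by
  by_contra hfI
  rw [Ideal.radical_eq_jacobson, Ideal.jacobson, Ideal.mem_sInf] at hfI
  push Not at hfI
  obtain ⟨m, ⟨hIm, hm⟩, hfm⟩ := hfI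
  let q := Ideal.Quotient.mk (Ideal.span (Set.range quadric))
  -- Three equations lower the height of m from 8 to no less than 5.
  have hht := Ideal.height_le_height_add_encard_of_subset (Set.range quadric) (p := m)
    (Ideal.span_le.mp hIm)
  have hcard : (Set.range quadric).encard ≤ 3 := by
    rw [← Set.image_univ]
    exact (Set.encard_image_le _ _).trans (by simp [Set.encard_univ])
  have : (m.map q).IsPrime := Ideal.isPrime_map_quotientMk_of_isPrime hIm
  have h5 : (5 : ℕ) ≤ Order.height (⟨m.map q, this⟩ : PrimeSpectrum _) := by
    rw [← PrimeSpectrum.height_eq_orderHeight]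
    rw [height_eq_of_isMaximal m hm, Nat.card_eq_fintype_card, Fintype.card_fin] at hht
    have h8 : (5 : ℕ∞) + 3 ≤ (m.map q).height + 3 := by
      have h : ((8 : ℕ) : ℕ∞) = 5 + 3 := by norm_num
      rw [← h]
      exact hht.trans (by gcongr)
    exact (ENat.add_le_add_iff_right (by simp)).mp h8
  -- The least prime of this chain lies in m and so misses f; hence it contains `openForm`.
  obtain ⟨p, hlast, hlen⟩ := Order.exists_series_of_le_height _ h5
  let P (i : Fin (p.length + 1)) : PrimeSpectrum (MvPolynomial (Fin 8) ℂ) :=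
    PrimeSpectrum.comap q (p i)
  have hPI : idealX.toIdeal ≤ (P 0).asIdeal := fun a ha => by
    change q a ∈ (p 0).asIdeal
    have h0 : q a = 0 := Ideal.Quotient.eq_zero_iff_mem.mpr ha
    rw [h0]
    exact zero_mem _
  have hPm : (P 0).asIdeal ≤ m := fun a ha => by
    have h1 : q a ∈ m.map q := by
      have hle : p 0 ≤ p.last := p.strictMono.monotone (Fin.zero_le _)
      rw [hlast] at hle
      exact hle ha
    have h2 := Ideal.comap_map_of_surjective q Ideal.Quotient.mk_surjective m
    have h3 : a ∈ (m.map q).comap q := h1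
    rw [h2, ← RingHom.ker_eq_comap_bot, Ideal.mk_ker] at h3
    exact (sup_le le_rfl hIm) h3
  have hg : openForm (fun j => (X j : MvPolynomial (Fin 8) ℂ)) ∈ (P 0).asIdeal :=
    (((P 0).isPrime.mem_or_mem
      ((P 0).isPrime.radical_le_iff.mpr hPI hf)).resolve_left fun h => hfm (hPm h))
  have hdim := ringKrullDim_quotient_le_four (P 0).asIdeal hPI hg
  have hstrict : StrictMono (PrimeSpectrum.comap q) := fun a b hab =>
    lt_of_le_of_ne (fun _ h => hab.le h)
      fun h => hab.ne (PrimeSpectrum.comap_injective_of_surjective q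
        Ideal.Quotient.mk_surjective h)
  let c : LTSeries (PrimeSpectrum.zeroLocus ((P 0).asIdeal : Set (MvPolynomial (Fin 8) ℂ))) :=
    { length := p.length
      toFun := fun i => ⟨P i, hstrict.monotone (p.strictMono.monotone (Fin.zero_le i))⟩
      step := fun i => hstrict (p.step i) }
  have h := Order.LTSeries.length_le_krullDim c
  rw [← ringKrullDim_quotient] at h
  have h4 : ((5 : ℕ) : WithBot ℕ∞) ≤ ((4 : ℕ) : WithBot ℕ∞) := by
    rw [← hlen]
    exact h.trans hdim
  have h4' : (5 : ℕ) ≤ 4 := by exact_mod_cast h4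
  omega

end Dimension

/-! ### Homogeneity of the open form and density of its nonvanishing locus in X. -/

section Density

theorem isHomogeneous_quadGrad {x : Fin 8 → MvPolynomial (Fin 8) ℂ}
    (hx : ∀ j, (x j).IsHomogeneous 1) (i : Fin 3) (j : Fin 8) :
    (quadGrad x i j).IsHomogeneous 1 := by
  have h : quadGrad x i j = aeval x (pderiv j (quadric i)) := by
    rw [pderiv_quadric]
    refine Eq.trans ?_ (map_quadGrad (aeval (R := ℂ) x).toRingHom _ i j).symm
    simp
  rw [h]
  exact (isHomogeneous_quadric i).pderiv.aeval x hx

theorem isHomogeneous_projTail (j : Fin 8) :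
    (projTail (fun j => (X j : MvPolynomial (Fin 8) ℂ)) j).IsHomogeneous 1 := by
  fin_cases j
  · exact isHomogeneous_zero _ _ _
  · exact isHomogeneous_zero _ _ _
  all_goals exact isHomogeneous_X _ _

theorem isHomogeneous_openForm :
    (openForm fun j => (X j : MvPolynomial (Fin 8) ℂ)).IsHomogeneous 8 := by
  have hX (i : Fin 3) (j : Fin 8) :
      (quadGrad (fun j => (X j : MvPolynomial (Fin 8) ℂ)) i j).IsHomogeneous 1 :=
    isHomogeneous_quadGrad (fun j => isHomogeneous_X _ _) i j
  have hc (i : Fin 3) : (crossVec (fun j => (X j : MvPolynomial (Fin 8) ℂ)) i).IsHomogeneous 2 := by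
    fin_cases i <;> exact ((hX _ _).mul (hX _ _)).sub ((hX _ _).mul (hX _ _))
  have ht (i : Fin 3) (j : Fin 8) :
      (quadGrad (projTail fun j => (X j : MvPolynomial (Fin 8) ℂ)) i j).IsHomogeneous 1 :=
    isHomogeneous_quadGrad isHomogeneous_projTail i j
  refine ((isHomogeneous_X ℂ (7 : Fin 8)).mul (hc 1)).mul (n := 5) ?_
  refine IsHomogeneous.sum _ _ _ fun i _ => (hc i).mul (n := 3) ?_
  exact (((ht _ _).mul (hc _)).add ((ht _ _).mul (hc _))).add ((ht _ _).mul (hc _))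

/-- The residue class of `openForm`. -/
def openElem : MvPolynomial (Fin 8) ℂ ⧸ idealX.toIdeal :=
  Ideal.Quotient.mk _ (openForm fun j => X j)

theorem openElem_mem : openElem ∈ quotGrading idealX 8 :=
  mk_mem_quotGrading idealX isHomogeneous_openForm

theorem isNilpotent_of_mul_openElem {a : MvPolynomial (Fin 8) ℂ ⧸ idealX.toIdeal}
    (h : IsNilpotent (a * openElem)) : IsNilpotent a := by
  obtain ⟨p, rfl⟩ := Ideal.Quotient.mk_surjective a
  obtain ⟨n, hn⟩ := h
  rw [openElem, ← map_mul, ← map_pow, Ideal.Quotient.eq_zero_iff_mem] at hn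
  obtain ⟨k, hk⟩ := mem_radical_of_mul_openForm_mem ⟨n, hn⟩
  exact ⟨k, by rw [← map_pow]; exact Ideal.Quotient.eq_zero_iff_mem.mpr hk⟩

/-- The coordinate ring of this affine open is nonzero because no power of f vanishes. -/
theorem nonempty_basicOpen {A : Type*} [CommRing A] {K : Type*} [CommRing K] [Algebra K A]
    (𝒜 : ℕ → Submodule K A) [GradedAlgebra 𝒜] {f : A} {n : ℕ} (hf : f ∈ 𝒜 n) (hn : 0 < n)
    (h : ¬ IsNilpotent f) : ∃ y : Proj 𝒜, y ∈ Proj.basicOpen 𝒜 f := by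
  have : Nontrivial (HomogeneousLocalization.Away 𝒜 f) := by
    by_contra hs
    rw [not_nontrivial_iff_subsingleton] at hs
    have h1 := congrArg HomogeneousLocalization.val
      (Subsingleton.elim (1 : HomogeneousLocalization.Away 𝒜 f) 0)
    rw [HomogeneousLocalization.val_one, HomogeneousLocalization.val_zero,
      ← map_one (algebraMap A _), ← map_zero (algebraMap A _),
      IsLocalization.eq_iff_exists (Submonoid.powers f)] at h1
    obtain ⟨⟨_, k, rfl⟩, hk⟩ := h1
    exact h ⟨k, by simpa using hk⟩
  obtain ⟨z⟩ : Nonempty (PrimeSpectrum (HomogeneousLocalization.Away 𝒜 f)) := inferInstance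
  refine ⟨Proj.awayι 𝒜 f hf hn z, ?_⟩
  rw [← Proj.opensRange_awayι 𝒜 f hf hn]
  exact ⟨z, rfl⟩

theorem dense_basicOpen_openElem :
    Dense (Proj.basicOpen (quotGrading idealX) openElem : Set (Proj (quotGrading idealX))) := by
  rw [dense_iff_inter_open]
  rintro U hU ⟨x, hx⟩
  obtain ⟨_, ⟨f, rfl⟩, hxf, hfU⟩ :=
    TopologicalSpace.Opens.isBasis_iff_nbhd.mp (Proj.isBasis_basicOpen (quotGrading idealX))
      (U := ⟨U, hU⟩) hx
  rw [Proj.basicOpen_eq_iSup_proj] at hxf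
  obtain ⟨n, hn⟩ := TopologicalSpace.Opens.mem_iSup.mp hxf
  obtain ⟨i, hi⟩ := TopologicalSpace.Opens.mem_iSup.mp
    ((Proj.iSup_basicOpen_eq_top (quotGrading idealX) coord irrelevant_le_span_coord).ge
      (Set.mem_univ x))
  set a := GradedRing.proj (quotGrading idealX) n f with ha
  have hfa : a ∈ quotGrading idealX n := SetLike.coe_mem _
  have hmem : a * coord i * openElem ∈ quotGrading idealX (n + 1 + 8) :=
    SetLike.mul_mem_graded (SetLike.mul_mem_graded hfa (coord_mem i)) openElem_mem
  -- Otherwise the product without `openElem` would be nilpotent and lie in the prime x, yet neither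
  -- factor vanishes at x.
  have hnil : ¬ IsNilpotent (a * coord i * openElem) := by
    intro h
    obtain ⟨k, hk⟩ := isNilpotent_of_mul_openElem h
    have hP := x.isPrime
    have : a * coord i ∈ x.asHomogeneousIdeal.toIdeal :=
      hP.mem_of_pow_mem k (hk ▸ zero_mem _)
    exact (hP.mem_or_mem this).elim hn hi
  obtain ⟨y, hy⟩ := nonempty_basicOpen (quotGrading idealX) hmem (by omega) hnil
  rw [Proj.basicOpen_mul, Proj.basicOpen_mul] at hy
  refine ⟨y, hfU ?_, hy.2⟩
  rw [Proj.basicOpen_eq_iSup_proj]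
  exact TopologicalSpace.Opens.mem_iSup.mpr ⟨n, hy.1.1⟩

end Density

/-! ### Rationality -/

section Rationality

/-- The inclusion of the open subset where `openForm` does not vanish. -/
def openι : Spec (CommRingCat.of OpenRing) ⟶ fourfold :=
  Spec.map (CommRingCat.ofHom (algebraMap (ChartRing 7) OpenRing)) ≫ chartι 7

instance isOpenImmersion_openι : IsOpenImmersion openι := IsOpenImmersion.comp _ _

theorem mem_range_openι (y : Proj (quotGrading idealX))
    (hy : y ∈ Proj.basicOpen (quotGrading idealX) openElem) :
    y ∈ Set.range (fun w => (openι w : Proj (quotGrading idealX))) := by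
  have hy7 : y ∈ Proj.basicOpen (quotGrading idealX) (coord 7) := by
    -- The factor x_7 places the nonvanishing locus inside the chart x_7 ≠ 0.
    have h : openElem = coord 7 * Ideal.Quotient.mk _ (crossVec (fun j => X j) 1
        * sectionPolar (crossVec fun j => X j) (projTail fun j => X j)) := by
      rw [openElem, openForm, mul_assoc, map_mul]
    rw [h, Proj.basicOpen_mul] at hy
    exact hy.1
  rw [← Proj.opensRange_awayι (quotGrading idealX) (coord 7) (coord_mem 7) one_pos] at hy7
  obtain ⟨z, rfl⟩ := hy7
  have hz : z ∈ Proj.awayι (quotGrading idealX) (coord 7) (coord_mem 7) one_pos ⁻¹ᵁ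
      Proj.basicOpen (quotGrading idealX) openElem := hy
  rw [Proj.awayι_preimage_basicOpen (quotGrading idealX) (coord_mem 7) one_pos openElem_mem
    (by norm_num)] at hz
  obtain ⟨z', rfl⟩ :=
    (Spec.map (CommRingCat.ofHom (chartEquiv 7).toRingHom)).surjective z
  have hz' : z' ∈ PrimeSpectrum.basicOpen (Ideal.Quotient.mk (Ideal.span (Set.range (chartEqs 7)))
      (openForm fun j => (X j : MvPolynomial (Fin 8) ℂ))) := by
    have h1 : chartEquiv 7 (HomogeneousLocalization.Away.isLocalizationElem (coord_mem 7)
        openElem_mem) = Ideal.Quotient.mk _ (openForm fun j => X j) := by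
      refine (chartEquiv_mk 7 8 ((openForm fun j => X j) ^ 1) _).trans ?_
      rw [pow_one]
    rw [← h1]
    exact hz
  have hrange := PrimeSpectrum.localization_away_comap_range OpenRing
    (Ideal.Quotient.mk (Ideal.span (Set.range (chartEqs 7)))
      (openForm fun j => (X j : MvPolynomial (Fin 8) ℂ)))
  obtain ⟨w, rfl⟩ := hrange.symm.subset hz'
  exact ⟨w, rfl⟩

instance isDominant_openι : IsDominant openι :=
  ⟨dense_basicOpen_openElem.mono mem_range_openι⟩

theorem openι_comp_fourfoldStr :
    openι ≫ fourfoldStr = Spec.map (CommRingCat.ofHom (algebraMap ℂ OpenRing)) := by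
  rw [openι, Category.assoc, chartι_comp_fourfoldStr, ← Spec.map_comp, ← CommRingCat.ofHom_comp,
    ← IsScalarTower.algebraMap_eq]

theorem paramForm_X_ne_zero : paramForm (fun i => (X i : MvPolynomial (Fin 4) ℂ)) ≠ 0 := by
  intro h
  have hev := congrArg (eval (0 : Fin 4 → ℂ)) h
  rw [map_paramForm, map_zero] at hev
  simp [paramForm, paramMinor, paramLin, paramConst, sectionPolar, netParam, liftPoint, quadVal,
    quadGrad, Fin.sum_univ_three] at hev
  norm_num at hev

/-- The inclusion of the open subset of affine space where `paramForm` does not vanish. -/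
def paramι : Spec (CommRingCat.of ParamRing) ⟶ 𝔸(Fin 4; Spec (CommRingCat.of ℂ)) :=
  Spec.map (CommRingCat.ofHom (algebraMap (MvPolynomial (Fin 4) ℂ) ParamRing)) ≫
    (AffineSpace.SpecIso (Fin 4) (CommRingCat.of ℂ)).inv

instance isOpenImmersion_paramι : IsOpenImmersion paramι := IsOpenImmersion.comp _ _

instance isDominant_paramι : IsDominant paramι := by
  have hinj : Function.Injective (algebraMap (MvPolynomial (Fin 4) ℂ) ParamRing) :=
    IsLocalization.injective _ (powers_le_nonZeroDivisors_of_noZeroDivisors paramForm_X_ne_zero)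
  have : IsDominant
      (Spec.map (CommRingCat.ofHom (algebraMap (MvPolynomial (Fin 4) ℂ) ParamRing))) := by
    refine ⟨PrimeSpectrum.denseRange_comap_iff_ker_le_nilRadical _ |>.mpr ?_⟩
    change RingHom.ker (algebraMap (MvPolynomial (Fin 4) ℂ) ParamRing) ≤ _
    rw [(RingHom.injective_iff_ker_eq_bot _).mp hinj]
    exact bot_le
  unfold paramι
  infer_instance

theorem paramι_comp_over :
    paramι ≫ (𝔸(Fin 4; Spec (CommRingCat.of ℂ)) ↘ Spec (CommRingCat.of ℂ))
      = Spec.map (CommRingCat.ofHom (algebraMap ℂ ParamRing)) := by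
  rw [paramι, Category.assoc, AffineSpace.SpecIso_inv_over, ← Spec.map_comp,
    ← CommRingCat.ofHom_comp]
  rfl

/-- The spectrum of `ParamRing` is a dense open subscheme of affine space and, through the ring
isomorphism, of X. -/
theorem birationalOver_fourfoldStr :
    Scheme.BirationalOver fourfoldStr
      (𝔸(Fin 4; Spec (CommRingCat.of ℂ)) ↘ Spec (CommRingCat.of ℂ)) := by
  obtain ⟨e⟩ := nonempty_openRing_algEquiv
  have : IsIso (Spec.map (CommRingCat.ofHom (e : OpenRing →+* ParamRing))) :=
    inferInstanceAs (IsIso (Spec.map e.toRingEquiv.toCommRingCatIso.hom))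
  have h₁ : Scheme.BirationalOver (Spec.map (CommRingCat.ofHom (algebraMap ℂ ParamRing)))
      fourfoldStr :=
    (Spec.map (CommRingCat.ofHom (e : OpenRing →+* ParamRing)) ≫ openι).birationalOver _ _ (by
      rw [Category.assoc, openι_comp_fourfoldStr, ← Spec.map_comp, ← CommRingCat.ofHom_comp]
      congr 2
      exact e.toAlgHom.comp_algebraMap)
  exact h₁.symm.trans (paramι.birationalOver _ _ paramι_comp_over)

end Rationality

end ThreeQuadrics

end

open ThreeQuadrics in
theorem proposition3p4 :
    -- `X` is smooth over `ℂ`, of dimension four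
    SmoothOfRelativeDimension 4 fourfoldStr ∧
    -- `X` is rational
    Scheme.BirationalOver fourfoldStr
      (𝔸(Fin 4; Spec (CommRingCat.of ℂ)) ↘ Spec (CommRingCat.of ℂ)) ∧
    -- `X` contains the line `x_2 = … = x_7 = 0`
    (∃ j : projScheme idealLine ⟶ fourfold, j ≫ projEmb idealX = projEmb idealLine) ∧
    -- the associated bundle is a quadric surface bundle with smooth general fibre
    (∀ l, IsQuadricSurface (bundleFiber l)) ∧
    (∃ (d : ℕ) (D : MvPolynomial (Fin 3) ℂ), D.IsHomogeneous d ∧ D ≠ 0 ∧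
      ∀ l, eval l.rep D ≠ 0 → IsSmoothQuadricSurface (bundleFiber l)) ∧
    -- the explicit rational section
    IsRationalSection ![X 0, X 1, X 2, 0, 0, 0] := by
  exact ⟨smoothOfRelativeDimension_fourfoldStr, birationalOver_fourfoldStr,
    exists_comp_projEmb_eq idealX_le_idealLine,
    fun l => ⟨fiberSpace l.rep, fiberForm l.rep, fiberForm_ne_zero l.rep_nonzero,
      isQuadricIn_bundleFiber l⟩,
    ⟨8, netDisc, isHomogeneous_netDisc, netDisc_ne_zero, fun l hl =>
      ⟨fiberSpace l.rep, fiberForm l.rep, nondegenerate_fiberForm (by rwa [eval_netDisc] at hl),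
        isQuadricIn_bundleFiber l⟩⟩,
    isRationalSection_net⟩
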